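/- Let $\mathbb{H}^3$ be the open unit ball of $\mathbb{R}^3$ with the hyperbolic metric, $S^2$ its boundary sphere, identified with $\hat{\mathbb{C}}=\mathbb{C}\cup\{\infty\}$ by the stereographic projection $z\mapsto\left(\frac{2z}{1+|z|^2},\frac{|z|^2-1}{|z|^2+1}\right)\in\mathbb{C}\times\mathbb{R}$, and $\mu_{S^2}$ the normalized spherical measure. For $x\in\mathbb{H}^3$ let $$M_x(z)=\frac{z(1-\|x\|^2)+x(1+\|z\|^2+2\langle x,z\rangle)}{1+\|x\|^2\|z\|^2+2\langle x,z\rangle},$$ the isometry of $\mathbb{H}^3$ with $M_x(0)=x$ and $M_x^{-1}=M_{-x}$, extended to $S^2$ by the same formula. A measure $\mu$ on $S^2$ is balanced at $y\in\mathbb{H}^3$ if $\int_{S^2}\zeta\,d\big((M_{-y})_*\mu\big)(\zeta)=0$; if there is exactly one such $y$, it is the barycenter of $\mu$. The barycentric extension $\mathscr{E}f:\mathbb{H}^3\to\mathbb{H}^3$ of $f:S^2\to S^2$ sends $x$ to the barycenter of $(f\circ M_x)_*\mu_{S^2}$. Let $(r,\theta,h)$, $r\ge 0$, be the hyperbolic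 cylindrical coordinates on $\mathbb{H}^3$ about the geodesic $\ell$ from $0$ to $\infty$: the point $(r,\theta,0)$ lies in the equatorial plane $\mathbb{H}^2_0$ (the hyperbolic plane through the origin orthogonal to $\ell$) and has hyperbolic polar coordinates $(r,\theta)$ there, and $(r,\theta,h)$ is the image of $(r,\theta,0)$ under the hyperbolic translation of signed length $h$ along $\ell$ (towards $\infty$ for $h>0$). **Theorem.** Let $f(z)=z^2$ on $\hat{\mathbb{C}}$. Then $\mathscr{E}f$ is well defined: for every $x\in\mathbb{H}^3$ the measure $(f\circ M_x)_*\mu_{S^2}$ is balanced at exactly one point. There is a real analytic function $\delta:[0,\infty)\to\mathbb{R}$ with $\delta(0)=0$, $\delta(r)>0$ for $r>0$ and $\lim_{r\to\infty}\delta(r)=0$, such that for all $r\ge 0$ and $\theta,h\in\mathbb{R}$ we have $\log(\cosh r)-\delta(r)\ge 0$ and $$\mathscr{E}f(r,\theta,h)=\big(\log(\cosh r)-\delta(r),\,2\theta,\,2h\big).$$ Consequently the restriction of $\mathscr{E}f$ to $\mathbb{H}^2_0$, identified with the unit disc $\{|z|<1\}$ by $z\mapsto(z,0)\in\mathbb{C}\times\mathbb{R}$,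 is not the map $z\mapsto z^2$. (This is the counterexample to a conjecture of Petersen.) -/

import Mathlib

open Filter Topology MeasureTheory

noncomputable section

namespace BaryExt

/-- Euclidean three-space. -/
abbrev E3 : Type := EuclideanSpace ℝ (Fin 3)

/-- Hyperbolic three-space in the Poincaré ball model: the open unit ball of `ℝ³`. -/
abbrev H3 : Type := Metric.ball (0 : E3) 1

/-- The unit sphere `S² ⊆ ℝ³`, the boundary at infinity of `H3`. -/
abbrev S2 : Type := Metric.sphere (0 : E3) 1

/-- The centre of the ball. -/
def origin : H3 := ⟨0, by simp⟩

instance : Nonempty H3 := ⟨origin⟩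

/-! ### The hyperbolic isometries `M_x` -/

/-- `M_x(z) = (z(1-|x|²) + x(1+|z|²+2⟨x,z⟩)) / (1+|x|²|z|²+2⟨x,z⟩)`. For `x` in the open unit
ball this is an orientation preserving isometry of the Poincaré ball (a translation along the
diameter through `x`) that sends `0` to `x`; its inverse is `M_{-x}`. The same formula gives its
extension to the unit sphere. -/
def mobius (x z : E3) : E3 :=
  (1 + ‖x‖ ^ 2 * ‖z‖ ^ 2 + 2 * inner ℝ x z)⁻¹ •
    ((1 - ‖x‖ ^ 2) • z + (1 + ‖z‖ ^ 2 + 2 * inner ℝ x z) • x)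

theorem mobius_zero (x : E3) : mobius x 0 = x := by
  simp [mobius]

theorem mobius_denom_pos {x z : E3} (hx : ‖x‖ < 1) (hz : ‖z‖ ≤ 1) :
    0 < 1 + ‖x‖ ^ 2 * ‖z‖ ^ 2 + 2 * inner ℝ x z := by
  have h1 := abs_real_inner_le_norm x z
  have h2 := neg_abs_le (inner ℝ x z)
  have h3 : ‖x‖ * ‖z‖ < 1 := by
    nlinarith [norm_nonneg x, norm_nonneg z]
  nlinarith [mul_pos (sub_pos.2 h3) (sub_pos.2 h3)]

theorem one_sub_norm_sq_mobius {x z : E3} (hx : ‖x‖ < 1) (hz : ‖z‖ ≤ 1) :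
    1 - ‖mobius x z‖ ^ 2 =
      (1 - ‖x‖ ^ 2) * (1 - ‖z‖ ^ 2) / (1 + ‖x‖ ^ 2 * ‖z‖ ^ 2 + 2 * inner ℝ x z) := by
  have hD := mobius_denom_pos hx hz
  unfold mobius
  rw [norm_smul, mul_pow, norm_add_sq_real, norm_smul, norm_smul, inner_smul_left,
    inner_smul_right, real_inner_comm x z, mul_pow, mul_pow]
  simp only [Real.norm_eq_abs, sq_abs, conj_trivial]
  field_simp
  ring

/-- The isometry `M_x` of hyperbolic space. -/
def mobiusBall (x z : H3) : H3 :=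
  ⟨mobius x z, by
    have hx := mem_ball_zero_iff.1 x.2
    have hz := mem_ball_zero_iff.1 z.2
    have hD := mobius_denom_pos hx hz.le
    have h := one_sub_norm_sq_mobius hx hz.le
    have h1 : 0 < 1 - ‖(x : E3)‖ ^ 2 := by nlinarith [norm_nonneg (x : E3)]
    have h2 : 0 < 1 - ‖(z : E3)‖ ^ 2 := by nlinarith [norm_nonneg (z : E3)]
    have h3 : 0 < 1 - ‖mobius (x : E3) (z : E3)‖ ^ 2 := by rw [h]; positivity
    rw [mem_ball_zero_iff]
    nlinarith [norm_nonneg (mobius (x : E3) (z : E3))]⟩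

/-- The extension of the isometry `M_x` to the sphere at infinity. -/
def mobiusSphere (x : H3) (ζ : S2) : S2 :=
  ⟨mobius x ζ, by
    have hx := mem_ball_zero_iff.1 x.2
    have hz : ‖(ζ : E3)‖ = 1 := mem_sphere_zero_iff_norm.1 ζ.2
    have h := one_sub_norm_sq_mobius hx hz.le
    rw [hz] at h
    rw [mem_sphere_zero_iff_norm]
    have h2 : ‖mobius (x : E3) (ζ : E3)‖ ^ 2 = 1 := by
      have : 1 - ‖mobius (x : E3) (ζ : E3)‖ ^ 2 = 0 := by rw [h]; simp
      linarith
    nlinarith [norm_nonneg (mobius (x : E3) (ζ : E3))]⟩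

/-! ### Barycentric extension -/

/-- The probability measure on the sphere coming from the spherical metric: the normalized
surface measure. -/
def sphereMeasure : Measure S2 :=
  ((volume : Measure E3).toSphere Set.univ)⁻¹ • (volume : Measure E3).toSphere

/-- A measure on the sphere is balanced if `∫ ζ dμ(ζ) = 0`. -/
def IsBalanced (μ : Measure S2) : Prop :=
  ∫ ζ : S2, (ζ : E3) ∂μ = 0

/-- `μ` is balanced at `y` if its push-forward by the isometry `M_{-y}`, which sends `y` to the
centre, is balanced. -/
def IsBalancedAt (μ : Measure S2) (y : H3) : Prop :=
  IsBalanced (μ.map (mobiusSphere (-y)))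

/-- The barycenter of `μ`: the point at which `μ` is balanced (an arbitrary point if there is
none). -/
def barycenter (μ : Measure S2) : H3 :=
  Classical.epsilon (IsBalancedAt μ)

/-- The barycentric extension of a map of the sphere: it sends `x` to the barycenter of
`(f ∘ M_x)_* μ_{S²}`, where `M_x` is an isometry sending the centre to `x`. -/
def barycentricExtension (f : S2 → S2) (x : H3) : H3 :=
  barycenter (sphereMeasure.map (f ∘ mobiusSphere x))

/-! ### The Riemann sphere as the sphere at infinity -/

/-- The point of the sphere that corresponds to `∞`. -/
def northPole : S2 :=
  ⟨!₂[0, 0, 1], by simp [EuclideanSpace.norm_eq, Fin.sum_univ_three]⟩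

/-- Stereographic projection `z ↦ (2z/(1+|z|²), (|z|²-1)/(|z|²+1))`, with values in
`ℂ × ℝ = ℝ³`. -/
def stereo (z : ℂ) : S2 :=
  ⟨!₂[2 * z.re / (1 + ‖z‖ ^ 2), 2 * z.im / (1 + ‖z‖ ^ 2), (‖z‖ ^ 2 - 1) / (‖z‖ ^ 2 + 1)], by
    have h : (0 : ℝ) < 1 + ‖z‖ ^ 2 := by positivity
    have hz : ‖z‖ ^ 2 = z.re ^ 2 + z.im ^ 2 := by
      rw [← Complex.normSq_eq_norm_sq, Complex.normSq_apply]; ring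
    rw [mem_sphere_zero_iff_norm, EuclideanSpace.norm_eq, Real.sqrt_eq_one]
    simp only [Fin.sum_univ_three, Real.norm_eq_abs, sq_abs, Matrix.cons_val]
    rw [add_comm (‖z‖ ^ 2) 1, hz] at *
    field_simp
    ring⟩

theorem sum_sq_eq_one (ζ : S2) : ζ.1 0 ^ 2 + ζ.1 1 ^ 2 + ζ.1 2 ^ 2 = 1 := by
  have h := mem_sphere_zero_iff_norm.1 ζ.2
  rw [EuclideanSpace.norm_eq, Real.sqrt_eq_one] at h
  simpa [Fin.sum_univ_three] using h

open Classical in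
/-- The identification of the Riemann sphere `ℂ ∪ {∞}` with `S²` by stereographic projection. -/
def riemannSphere : OnePoint ℂ ≃ S2 where
  toFun p := p.elim northPole stereo
  invFun ζ := if ζ = northPole then OnePoint.infty
    else ((⟨ζ.1 0 / (1 - ζ.1 2), ζ.1 1 / (1 - ζ.1 2)⟩ : ℂ) : OnePoint ℂ)
  left_inv p := by
    induction p using OnePoint.rec with
    | infty => simp
    | coe z =>
      have h : (0 : ℝ) < 1 + ‖z‖ ^ 2 := by positivity
      have h2 : 1 - (‖z‖ ^ 2 - 1) / (‖z‖ ^ 2 + 1) = 2 / (1 + ‖z‖ ^ 2) := by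
        rw [add_comm (‖z‖ ^ 2) 1]
        field_simp
        ring
      have hne : stereo z ≠ northPole := by
        intro he
        have h3 : (‖z‖ ^ 2 - 1) / (‖z‖ ^ 2 + 1) = 1 := by
          have := congrArg (fun ζ : S2 => ζ.1 2) he
          simpa [stereo, northPole] using this
        rw [h3] at h2
        have : 0 < 2 / (1 + ‖z‖ ^ 2) := by positivity
        linarith
      simp only [OnePoint.elim_some]
      refine (if_neg hne).trans (congrArg OnePoint.some ?_)
      apply Complex.ext
      · simp only [stereo, Matrix.cons_val]
        rw [h2]
        field_simp
      · simp only [stereo, Matrix.cons_val]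
        rw [h2]
        field_simp
  right_inv ζ := by
    by_cases hζ : ζ = northPole
    · simp [hζ]
    · simp only [if_neg hζ, OnePoint.elim_some]
      have hs := sum_sq_eq_one ζ
      have hlt : 0 < 1 - ζ.1 2 := by
        by_contra hcon
        apply hζ
        have e2 : ζ.1 2 = 1 := by nlinarith [sq_nonneg (ζ.1 0), sq_nonneg (ζ.1 1)]
        have e0 : ζ.1 0 = 0 := by nlinarith [sq_nonneg (ζ.1 0), sq_nonneg (ζ.1 1)]
        have e1 : ζ.1 1 = 0 := by nlinarith [sq_nonneg (ζ.1 0), sq_nonneg (ζ.1 1)]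
        apply Subtype.ext
        ext i
        fin_cases i <;> simp [northPole, e0, e1, e2]
      have hn : ‖(⟨ζ.1 0 / (1 - ζ.1 2), ζ.1 1 / (1 - ζ.1 2)⟩ : ℂ)‖ ^ 2 =
          (1 + ζ.1 2) / (1 - ζ.1 2) := by
        rw [← Complex.normSq_eq_norm_sq, Complex.normSq_apply]
        field_simp
        nlinarith
      have hp : 1 + (1 + ζ.1 2) / (1 - ζ.1 2) = 2 / (1 - ζ.1 2) := by
        field_simp
        ring
      apply Subtype.ext
      ext i
      fin_cases i
      · simp only [stereo, Fin.zero_eta, Matrix.cons_val]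
        rw [hn, hp]
        field_simp
      · simp only [stereo, Fin.mk_one, Matrix.cons_val]
        rw [hn, hp]
        field_simp
      · simp only [stereo, Fin.reduceFinMk, Matrix.cons_val]
        rw [hn, add_comm _ (1 : ℝ), hp]
        field_simp
        ring

/-- The rational map `z ↦ z²` of the Riemann sphere (with `∞ ↦ ∞`), as a map of `S²`. -/
def squareMap (ζ : S2) : S2 :=
  riemannSphere (OnePoint.map (fun z : ℂ => z ^ 2) (riemannSphere.symm ζ))

/-! ### Cylindrical coordinates -/

/-- The point of the equatorial hyperbolic plane with hyperbolic polar coordinates `(r, θ)`. -/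
def polar (r θ : ℝ) : H3 :=
  ⟨!₂[Real.tanh (r / 2) * Real.cos θ, Real.tanh (r / 2) * Real.sin θ, 0], by
    rw [mem_ball_zero_iff, EuclideanSpace.norm_eq, Real.sqrt_lt' one_pos]
    simp only [Fin.sum_univ_three, Real.norm_eq_abs, sq_abs, Matrix.cons_val]
    nlinarith [Real.tanh_sq_lt_one (r / 2), Real.sin_sq_add_cos_sq θ]⟩

/-- The point of the vertical diameter at signed hyperbolic distance `h` from the centre. -/
def axisPoint (h : ℝ) : H3 :=
  ⟨!₂[0, 0, Real.tanh (h / 2)], by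
    rw [mem_ball_zero_iff, EuclideanSpace.norm_eq, Real.sqrt_lt' one_pos]
    simp only [Fin.sum_univ_three, Real.norm_eq_abs, sq_abs, Matrix.cons_val]
    nlinarith [Real.tanh_sq_lt_one (h / 2)]⟩

/-- The point with hyperbolic cylindrical coordinates `(r, θ, h)` about the vertical geodesic
(from `0` to `∞` on the Riemann sphere): the point `(r, θ)` of the equatorial plane, moved by the
hyperbolic translation of signed length `h` along that geodesic. So `r` is the distance to the
geodesic, `h` the signed position of the foot of the perpendicular on it, `θ` the angle, and the
hyperbolic metric is `dr² + sinh² r dθ² + cosh² r dh²`. -/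
def cylindrical (r θ h : ℝ) : H3 :=
  mobiusBall (axisPoint h) (polar r θ)

/-- The isometric identification of the Poincaré disc with the equatorial hyperbolic plane. -/
def equator (z : Complex.UnitDisc) : H3 :=
  ⟨!₂[(z : ℂ).re, (z : ℂ).im, 0], by
    have h := z.normSq_lt_one
    rw [Complex.normSq_apply] at h
    rw [mem_ball_zero_iff, EuclideanSpace.norm_eq, Real.sqrt_lt' one_pos]
    simp only [Fin.sum_univ_three, Real.norm_eq_abs, sq_abs, Matrix.cons_val]
    nlinarith⟩

end BaryExt

end

noncomputable section
namespace BaryExt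

/-! ### The isometries on the sphere -/

theorem norm_sphere (ζ : S2) : ‖(ζ : E3)‖ = 1 := mem_sphere_zero_iff_norm.1 ζ.2

theorem norm_ball (x : H3) : ‖(x : E3)‖ < 1 := mem_ball_zero_iff.1 x.2

theorem one_sub_norm_sq_pos (x : H3) : 0 < 1 - ‖(x : E3)‖ ^ 2 := by
  nlinarith [norm_ball x, norm_nonneg (x : E3)]

theorem norm_add_sq_pos {x ζ : E3} (hx : ‖x‖ < 1) (hζ : ‖ζ‖ = 1) : 0 < ‖ζ + x‖ ^ 2 := by
  have : ζ + x ≠ 0 := by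
    intro h
    have h1 : x = -ζ := by rw [eq_neg_iff_add_eq_zero, add_comm]; exact h
    rw [h1, norm_neg, hζ] at hx
    exact lt_irrefl _ hx
  positivity

/-- On the unit sphere `M_x` is an inversion-like map centred at `-x`. -/
theorem mobius_of_norm_eq_one {x ζ : E3} (hx : ‖x‖ < 1) (hζ : ‖ζ‖ = 1) :
    mobius x ζ = x + ((1 - ‖x‖ ^ 2) / ‖ζ + x‖ ^ 2) • (ζ + x) := by
  have hp := norm_add_sq_pos hx hζ
  have hD : ‖ζ + x‖ ^ 2 = 1 + ‖x‖ ^ 2 * ‖ζ‖ ^ 2 + 2 * inner ℝ x ζ := by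
    rw [norm_add_sq_real, hζ, real_inner_comm]; ring
  rw [mobius, ← hD]
  have h2 : (1 + ‖ζ‖ ^ 2 + 2 * inner ℝ x ζ) = ‖ζ + x‖ ^ 2 + (1 - ‖x‖ ^ 2) := by
    rw [hD, hζ]; ring
  rw [h2]
  have : x = (‖ζ + x‖ ^ 2)⁻¹ • (‖ζ + x‖ ^ 2 • x) := by
    rw [smul_smul, inv_mul_cancel₀ hp.ne', one_smul]
  rw [div_eq_inv_mul, mul_smul]
  nth_rewrite 6 [this]
  rw [← smul_add]
  congr 1
  module

theorem mobius_neg_mobius {x ζ : E3} (hx : ‖x‖ < 1) (hζ : ‖ζ‖ = 1) (hM : ‖mobius x ζ‖ = 1) :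
    mobius (-x) (mobius x ζ) = ζ := by
  have hp := norm_add_sq_pos hx hζ
  have hx2 : 0 < 1 - ‖x‖ ^ 2 := by nlinarith [norm_nonneg x]
  rw [mobius_of_norm_eq_one (by simpa using hx) hM, mobius_of_norm_eq_one hx hζ, norm_neg]
  have : x + ((1 - ‖x‖ ^ 2) / ‖ζ + x‖ ^ 2) • (ζ + x) + -x
      = ((1 - ‖x‖ ^ 2) / ‖ζ + x‖ ^ 2) • (ζ + x) := by abel
  rw [this, norm_smul, mul_pow, smul_smul, Real.norm_eq_abs, sq_abs]
  have : (1 - ‖x‖ ^ 2) / (((1 - ‖x‖ ^ 2) / ‖ζ + x‖ ^ 2) ^ 2 * ‖ζ + x‖ ^ 2) *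
      ((1 - ‖x‖ ^ 2) / ‖ζ + x‖ ^ 2) = 1 := by
    generalize ‖ζ + x‖ ^ 2 = A at *
    generalize 1 - ‖x‖ ^ 2 = B at *
    field_simp
  rw [this, one_smul]
  abel

theorem coe_neg_H3 (x : H3) : ((-x : H3) : E3) = -(x : E3) := rfl

theorem mobiusSphere_neg_mobiusSphere (x : H3) (ζ : S2) :
    mobiusSphere (-x) (mobiusSphere x ζ) = ζ :=
  Subtype.ext (mobius_neg_mobius (norm_ball x) (norm_sphere ζ) (norm_sphere (mobiusSphere x ζ)))

theorem mobiusSphere_mobiusSphere_neg (x : H3) (ζ : S2) :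
    mobiusSphere x (mobiusSphere (-x) ζ) = ζ := by
  simpa using mobiusSphere_neg_mobiusSphere (-x) ζ

theorem mobiusSphere_surjective (x : H3) : Function.Surjective (mobiusSphere x) :=
  fun ζ => ⟨_, mobiusSphere_mobiusSphere_neg x ζ⟩

theorem continuous_mobiusSphere (x : H3) : Continuous (mobiusSphere x) := by
  refine Continuous.subtype_mk ?_ _
  have : ∀ ζ : S2, (1 + ‖(x : E3)‖ ^ 2 * ‖(ζ : E3)‖ ^ 2 + 2 * inner ℝ (x : E3) (ζ : E3)) ≠ 0 :=
    fun ζ => (mobius_denom_pos (norm_ball x) (norm_sphere ζ).le).ne'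
  unfold mobius
  fun_prop (disch := assumption)

/-! ### Uniqueness of the barycenter -/

theorem norm_sub_sq_pos (y : H3) (ζ : S2) : 0 < ‖(ζ : E3) - y‖ ^ 2 := by
  have := norm_add_sq_pos (norm_ball (-y)) (norm_sphere ζ)
  rwa [coe_neg_H3, ← sub_eq_add_neg] at this

/-- The exponential of the Busemann function at `ζ`. -/
def busemannExp (y : H3) (ζ : S2) : ℝ := ‖(ζ : E3) - y‖ ^ 2 / (1 - ‖(y : E3)‖ ^ 2)

theorem busemannExp_pos (y : H3) (ζ : S2) : 0 < busemannExp y ζ :=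
  div_pos (norm_sub_sq_pos y ζ) (one_sub_norm_sq_pos y)

theorem continuous_busemannExp (y : H3) : Continuous (busemannExp y) := by
  unfold busemannExp; fun_prop

theorem mobiusSphere_neg_eq (y : H3) (ζ : S2) :
    (mobiusSphere (-y) ζ : E3) = (busemannExp y ζ)⁻¹ • ((ζ : E3) - y) - y := by
  have := mobius_of_norm_eq_one (norm_ball (-y)) (norm_sphere ζ)
  rw [coe_neg_H3, norm_neg, ← sub_eq_add_neg] at this
  rw [busemannExp, inv_div]
  change mobius _ _ = _
  rw [coe_neg_H3, this]
  abel

theorem integrable_of_continuous_S2 {F : Type*} [NormedAddCommGroup F]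
    [SecondCountableTopology F] {μ : Measure S2} [IsFiniteMeasure μ]
    {g : S2 → F} (hg : Continuous g) : Integrable g μ := by
  obtain ⟨M, hM⟩ := (isCompact_univ.image hg).isBounded.exists_norm_le
  exact Integrable.of_bound hg.aestronglyMeasurable M
    (ae_of_all _ fun x => hM _ ⟨x, Set.mem_univ _, rfl⟩)

/-- `cosh` of the hyperbolic distance between `y` and `w`. -/
def coshDist (y w : H3) : ℝ :=
  1 + 2 * ‖(y : E3) - w‖ ^ 2 / ((1 - ‖(y : E3)‖ ^ 2) * (1 - ‖(w : E3)‖ ^ 2))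

theorem coshDist_comm (y w : H3) : coshDist y w = coshDist w y := by
  rw [coshDist, coshDist, norm_sub_rev, mul_comm (1 - _ : ℝ)]

theorem integral_busemannExp_ratio {μ : Measure S2} [IsProbabilityMeasure μ] {y : H3}
    (hy : IsBalancedAt μ y) (w : H3) :
    ∫ ζ, busemannExp w ζ * (busemannExp y ζ)⁻¹ ∂μ = coshDist y w := by
  have hy2 := one_sub_norm_sq_pos y
  have hw2 := one_sub_norm_sq_pos w
  have hc := continuous_mobiusSphere (-y)
  have hcb : Continuous fun ζ => (busemannExp y ζ)⁻¹ :=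
    (continuous_busemannExp y).inv₀ fun ζ => (busemannExp_pos y ζ).ne'
  have h0 : ∫ ζ, (mobiusSphere (-y) ζ : E3) ∂μ = 0 := by
    have h1 := hy
    unfold IsBalancedAt IsBalanced at h1
    rwa [integral_map hc.aemeasurable
      continuous_subtype_val.aestronglyMeasurable] at h1
  have key (e : E3) : ∫ ζ, inner ℝ e ((busemannExp y ζ)⁻¹ • ((ζ : E3) - y)) ∂μ =
      inner ℝ e (y : E3) := by
    have h2 : ∫ ζ, (busemannExp y ζ)⁻¹ • ((ζ : E3) - y) ∂μ = y := by
      simp_rw [mobiusSphere_neg_eq] at h0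
      rw [integral_sub (integrable_of_continuous_S2 (by fun_prop)) (integrable_const _)] at h0
      simpa [sub_eq_zero] using h0
    rw [integral_inner (𝕜 := ℝ) (integrable_of_continuous_S2 (by fun_prop)), h2]
  have hinv : ∫ ζ, (busemannExp y ζ)⁻¹ ∂μ = (1 + ‖(y : E3)‖ ^ 2) / (1 - ‖(y : E3)‖ ^ 2) := by
    have h3 (ζ : S2) : (busemannExp y ζ)⁻¹ = (1 - ‖(y : E3)‖ ^ 2)⁻¹ *
        ((1 - ‖(y : E3)‖ ^ 2) + 2 * inner ℝ (y : E3) ((busemannExp y ζ)⁻¹ • ((ζ : E3) - y))) := by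
      have hp := norm_sub_sq_pos y ζ
      have h4 : ‖(ζ : E3) - y‖ ^ 2 =
          1 - ‖(y : E3)‖ ^ 2 - 2 * inner ℝ (y : E3) ((ζ : E3) - y) := by
        rw [norm_sub_sq_real, norm_sphere, inner_sub_right, real_inner_self_eq_norm_sq,
          real_inner_comm]
        ring
      have h5 : inner ℝ (y : E3) ((ζ : E3) - y) =
          (1 - ‖(y : E3)‖ ^ 2 - ‖(ζ : E3) - y‖ ^ 2) / 2 := by rw [h4]; ring
      rw [inner_smul_right, busemannExp, inv_div, h5]
      generalize ‖(ζ : E3) - y‖ ^ 2 = A at *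
      field_simp
      ring
    rw [integral_congr_ae (ae_of_all _ h3), integral_const_mul, integral_add (integrable_const _)
      (integrable_of_continuous_S2 (by fun_prop)), integral_const_mul, key,
      real_inner_self_eq_norm_sq]
    simp
    field_simp
    ring
  have h5 (ζ : S2) : busemannExp w ζ * (busemannExp y ζ)⁻¹ = (1 - ‖(w : E3)‖ ^ 2)⁻¹ *
      ((1 - ‖(y : E3)‖ ^ 2) +
        (2 * inner ℝ ((y : E3) - w) ((busemannExp y ζ)⁻¹ • ((ζ : E3) - y)) +
        ‖(y : E3) - w‖ ^ 2 * (busemannExp y ζ)⁻¹)) := by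
    have hp := norm_sub_sq_pos y ζ
    have h4 : ‖(ζ : E3) - w‖ ^ 2 = ‖(ζ : E3) - y‖ ^ 2 +
        2 * inner ℝ ((y : E3) - w) ((ζ : E3) - y) + ‖(y : E3) - w‖ ^ 2 := by
      rw [real_inner_comm, ← norm_add_sq_real]
      congr 2
      abel
    have h6 : inner ℝ ((y : E3) - w) ((ζ : E3) - y) =
        (‖(ζ : E3) - w‖ ^ 2 - ‖(ζ : E3) - y‖ ^ 2 - ‖(y : E3) - w‖ ^ 2) / 2 := by rw [h4]; ring
    rw [inner_smul_right, busemannExp, busemannExp, inv_div, h6]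
    generalize ‖(ζ : E3) - y‖ ^ 2 = A at *
    field_simp
    ring
  rw [integral_congr_ae (ae_of_all _ h5), integral_const_mul, integral_add (integrable_const _)
      (integrable_of_continuous_S2 (by fun_prop)),
      integral_add (integrable_of_continuous_S2 (by fun_prop))
      (integrable_of_continuous_S2 (by fun_prop)), integral_const_mul, integral_const_mul, key,
      hinv]
  have h6 : ‖(y : E3) - w‖ ^ 2 = ‖(y : E3)‖ ^ 2 - 2 * inner ℝ (y : E3) (w : E3)
      + ‖(w : E3)‖ ^ 2 := norm_sub_sq_real _ _
  rw [inner_sub_left, real_inner_self_eq_norm_sq, real_inner_comm, coshDist]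
  have h7 : inner ℝ (y : E3) (w : E3) =
      (‖(y : E3)‖ ^ 2 + ‖(w : E3)‖ ^ 2 - ‖(y : E3) - w‖ ^ 2) / 2 := by rw [h6]; ring
  rw [h7]
  simp only [integral_const, probReal_univ, one_smul]
  generalize ‖(y : E3) - w‖ ^ 2 = A at *
  field_simp
  ring

theorem sq_sub_le_of_norm_eq_one {ζ p q : E3} (hζ : ‖ζ‖ = 1) :
    (‖p‖ ^ 2 * (1 - ‖ζ - q‖ ^ 2) - ‖q‖ ^ 2 * (1 - ‖ζ - p‖ ^ 2)) ^ 2 ≤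
      4 * (‖p‖ ^ 2 * ‖q‖ ^ 2 * ‖q - p‖ ^ 2) := by
  have h1 : ‖p‖ ^ 2 * (1 - ‖ζ - q‖ ^ 2) - ‖q‖ ^ 2 * (1 - ‖ζ - p‖ ^ 2) =
      2 * inner ℝ ζ (‖p‖ ^ 2 • q - ‖q‖ ^ 2 • p) := by
    rw [norm_sub_sq_real, norm_sub_sq_real, hζ, inner_sub_right,
      inner_smul_right, inner_smul_right]
    ring
  have h2 : ‖‖p‖ ^ 2 • q - ‖q‖ ^ 2 • p‖ ^ 2 = ‖p‖ ^ 2 * ‖q‖ ^ 2 * ‖q - p‖ ^ 2 := by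
    rw [norm_sub_sq_real, norm_sub_sq_real, inner_smul_left, inner_smul_right, norm_smul,
      norm_smul]
    simp
    ring
  rw [h1, ← h2]
  have h3 := abs_real_inner_le_norm ζ (‖p‖ ^ 2 • q - ‖q‖ ^ 2 • p)
  rw [hζ, one_mul] at h3
  have h4 := sq_le_sq' (neg_le_of_abs_le h3) (le_of_abs_le h3)
  nlinarith

theorem busemannExp_sq_sub_le (y w : H3) (ζ : S2) :
    (‖(ζ : E3) - y‖ ^ 2 * (1 - ‖(w : E3)‖ ^ 2) - ‖(ζ : E3) - w‖ ^ 2 * (1 - ‖(y : E3)‖ ^ 2)) ^ 2 ≤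
      4 * (‖(ζ : E3) - y‖ ^ 2 * ‖(ζ : E3) - w‖ ^ 2 * ‖(y : E3) - w‖ ^ 2) := by
  have := sq_sub_le_of_norm_eq_one (norm_sphere ζ) (p := (ζ : E3) - y) (q := (ζ : E3) - w)
  simpa using this

theorem ratio_add_inv_eq (y w : H3) (ζ : S2) :
    2 * coshDist y w - (busemannExp w ζ * (busemannExp y ζ)⁻¹ +
      busemannExp y ζ * (busemannExp w ζ)⁻¹) =
    (4 * (‖(ζ : E3) - y‖ ^ 2 * ‖(ζ : E3) - w‖ ^ 2 * ‖(y : E3) - w‖ ^ 2) -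
    (‖(ζ : E3) - y‖ ^ 2 * (1 - ‖(w : E3)‖ ^ 2) -
      ‖(ζ : E3) - w‖ ^ 2 * (1 - ‖(y : E3)‖ ^ 2)) ^ 2) /
    (‖(ζ : E3) - y‖ ^ 2 * ‖(ζ : E3) - w‖ ^ 2 *
      ((1 - ‖(y : E3)‖ ^ 2) * (1 - ‖(w : E3)‖ ^ 2))) := by
  have hy := norm_sub_sq_pos y ζ
  have hw := norm_sub_sq_pos w ζ
  have hy2 := one_sub_norm_sq_pos y
  have hw2 := one_sub_norm_sq_pos w
  rw [coshDist, busemannExp, busemannExp, inv_div, inv_div]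
  generalize ‖(ζ : E3) - y‖ ^ 2 = A at *
  generalize ‖(ζ : E3) - w‖ ^ 2 = B at *
  generalize 1 - ‖(y : E3)‖ ^ 2 = a at *
  generalize 1 - ‖(w : E3)‖ ^ 2 = b at *
  field_simp
  ring

theorem exists_sphere_orthogonal (y w : E3) :
    ∃ ζ : S2, inner ℝ (ζ : E3) y = 0 ∧ inner ℝ (ζ : E3) w = 0 := by
  have hK : Submodule.span ℝ ({y, w} : Set E3) ≠ ⊤ := by
    intro h
    have h1 : Module.finrank ℝ (Submodule.span ℝ ({y, w} : Set E3)) = 3 := by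
      rw [h]; simp
    have h2 : Module.finrank ℝ (Submodule.span ℝ ((({y, w} : Finset E3) : Set E3))) ≤ _ :=
      finrank_span_finset_le_card ({y, w} : Finset E3)
    have h3 := Finset.card_le_two (a := y) (b := w)
    rw [Finset.coe_pair, h1] at h2
    omega
  have hK2 : (Submodule.span ℝ ({y, w} : Set E3))ᗮ ≠ ⊥ := by
    rwa [ne_eq, Submodule.orthogonal_eq_bot_iff]
  obtain ⟨z, hz, hz0⟩ := Submodule.exists_mem_ne_zero_of_ne_bot hK2
  have hn : ‖z‖ ≠ 0 := norm_ne_zero_iff.2 hz0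
  rw [Submodule.mem_orthogonal'] at hz
  refine ⟨⟨‖z‖⁻¹ • z, ?_⟩, ?_, ?_⟩
  · rw [mem_sphere_zero_iff_norm, norm_smul, norm_inv, norm_norm, inv_mul_cancel₀ hn]
  · rw [inner_smul_left, hz y (Submodule.subset_span (by simp)), mul_zero]
  · rw [inner_smul_left, hz w (Submodule.subset_span (by simp)), mul_zero]

theorem IsBalancedAt.unique {μ : Measure S2} [IsProbabilityMeasure μ] [μ.IsOpenPosMeasure]
    {y w : H3} (hy : IsBalancedAt μ y) (hw : IsBalancedAt μ w) : y = w := by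
  by_contra hne
  have hcy : Continuous fun ζ => (busemannExp y ζ)⁻¹ :=
    (continuous_busemannExp y).inv₀ fun ζ => (busemannExp_pos y ζ).ne'
  have hcw : Continuous fun ζ => (busemannExp w ζ)⁻¹ :=
    (continuous_busemannExp w).inv₀ fun ζ => (busemannExp_pos w ζ).ne'
  have hy' := continuous_busemannExp y
  have hw' := continuous_busemannExp w
  set G : S2 → ℝ := fun ζ => 2 * coshDist y w - (busemannExp w ζ * (busemannExp y ζ)⁻¹ +
      busemannExp y ζ * (busemannExp w ζ)⁻¹) with hG
  have hGc : Continuous G := by fun_prop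
  have hden (ζ : S2) : 0 < ‖(ζ : E3) - y‖ ^ 2 * ‖(ζ : E3) - w‖ ^ 2 *
      ((1 - ‖(y : E3)‖ ^ 2) * (1 - ‖(w : E3)‖ ^ 2)) := by
    have := norm_sub_sq_pos y ζ
    have := norm_sub_sq_pos w ζ
    have := one_sub_norm_sq_pos y
    have := one_sub_norm_sq_pos w
    positivity
  have hG0 : 0 ≤ G := fun ζ => by
    simp only [hG, ratio_add_inv_eq, Pi.zero_apply]
    exact div_nonneg (sub_nonneg.2 (busemannExp_sq_sub_le y w ζ)) (hden ζ).le
  have hI : ∫ ζ, G ζ ∂μ = 0 := by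
    rw [integral_sub (integrable_const _) (integrable_of_continuous_S2 (by fun_prop)),
      integral_add (integrable_of_continuous_S2 (by fun_prop))
      (integrable_of_continuous_S2 (by fun_prop)), integral_busemannExp_ratio hy,
      integral_busemannExp_ratio hw, coshDist_comm w y]
    simp
    ring
  have hz : G = 0 := by
    have := (integral_eq_zero_iff_of_nonneg hG0 (integrable_of_continuous_S2 hGc)).1 hI
    exact (Continuous.ae_eq_iff_eq μ hGc continuous_const).1 this
  obtain ⟨ζ, h1, h2⟩ := exists_sphere_orthogonal (y : E3) (w : E3)
  have h3 := congrFun hz ζ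
  simp only [hG, ratio_add_inv_eq, Pi.zero_apply, div_eq_zero_iff, (hden ζ).ne', or_false] at h3
  rw [norm_sub_sq_real, norm_sub_sq_real (ζ : E3), h1, h2, norm_sphere] at h3
  have h4 : 0 < ‖(y : E3) - w‖ := norm_pos_iff.2 (sub_ne_zero.2 fun h => hne (Subtype.ext h))
  have h5 := abs_norm_sub_norm_le (y : E3) (w : E3)
  have h6 : (‖(y : E3)‖ - ‖(w : E3)‖) ^ 2 ≤ ‖(y : E3) - w‖ ^ 2 := by
    rw [← sq_abs]; gcongr
  have h7 : 0 < (1 - ‖(y : E3)‖ * ‖(w : E3)‖) ^ 2 := by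
    have := norm_ball y
    have := norm_ball w
    have : ‖(y : E3)‖ * ‖(w : E3)‖ < 1 := by
      nlinarith [norm_nonneg (y : E3), norm_nonneg (w : E3)]
    nlinarith
  have h8 := mul_le_mul_of_nonneg_right h6 (sq_nonneg (‖(y : E3)‖ + ‖(w : E3)‖))
  have h9 := mul_pos (pow_pos h4 2) h7
  nlinarith

end BaryExt
end


noncomputable section
namespace BaryExt

/-! ### Symmetries of the sphere and of its measure -/

instance : IsProbabilityMeasure sphereMeasure := by
  refine ⟨?_⟩
  rw [sphereMeasure, Measure.smul_apply, smul_eq_mul]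
  refine ENNReal.inv_mul_cancel ?_ (measure_ne_top _ _)
  rw [ne_eq, Measure.measure_univ_eq_zero]
  exact Measure.toSphere_ne_zero _

instance : sphereMeasure.IsOpenPosMeasure := by
  refine ⟨fun U hU hne => ?_⟩
  rw [sphereMeasure, Measure.smul_apply, smul_eq_mul]
  exact mul_ne_zero (ENNReal.inv_ne_zero.2 (measure_ne_top _ _)) (hU.measure_ne_zero _ hne)

/-- The action of a linear isometry on the sphere. -/
def sphereIso (L : E3 ≃ₗᵢ[ℝ] E3) (ζ : S2) : S2 :=
  ⟨L ζ, by rw [mem_sphere_zero_iff_norm, L.norm_map, norm_sphere]⟩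

/-- The action of a linear isometry on the ball. -/
def ballIso (L : E3 ≃ₗᵢ[ℝ] E3) (x : H3) : H3 :=
  ⟨L x, by rw [mem_ball_zero_iff, L.norm_map]; exact norm_ball x⟩

theorem continuous_sphereIso (L : E3 ≃ₗᵢ[ℝ] E3) : Continuous (sphereIso L) :=
  (L.continuous.comp continuous_subtype_val).subtype_mk _

open scoped Pointwise in
theorem map_sphereIso_sphereMeasure (L : E3 ≃ₗᵢ[ℝ] E3) :
    sphereMeasure.map (sphereIso L) = sphereMeasure := by
  have hm := (continuous_sphereIso L).measurable
  have key : ((volume : Measure E3).toSphere).map (sphereIso L) =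
      (volume : Measure E3).toSphere := by
    refine Measure.ext fun s hs => ?_
    rw [Measure.map_apply hm hs, Measure.toSphere_apply' _ hs, Measure.toSphere_apply' _ (hm hs),
      ← (L.measurePreserving).measure_preimage_emb L.toHomeomorph.measurableEmbedding
        (Set.Ioo (0 : ℝ) 1 • (Subtype.val '' s))]
    congr 2
    ext z
    simp only [Set.mem_smul, Set.mem_image, Set.mem_preimage]
    constructor
    · rintro ⟨r, hr, _, ⟨ζ, hζ, rfl⟩, rfl⟩
      exact ⟨r, hr, _, ⟨_, hζ, rfl⟩, (L.map_smul r _).symm⟩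
    · rintro ⟨r, hr, _, ⟨ζ, hζ, rfl⟩, h⟩
      refine ⟨r, hr, _, ⟨sphereIso L.symm ζ, ?_, rfl⟩, ?_⟩
      · have : sphereIso L (sphereIso L.symm ζ) = ζ := Subtype.ext (L.apply_symm_apply _)
        rwa [this]
      · apply L.injective
        rw [← h, L.map_smul]
        exact congrArg (r • ·) (L.apply_symm_apply (ζ : E3))
  rw [sphereMeasure, Measure.map_smul, key]

theorem integral_comp_sphereIso {F : Type*} [NormedAddCommGroup F] [NormedSpace ℝ F]
    (L : E3 ≃ₗᵢ[ℝ] E3) {g : S2 → F} (hg : Continuous g) :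
    ∫ ζ, g (sphereIso L ζ) ∂sphereMeasure = ∫ ζ, g ζ ∂sphereMeasure := by
  conv_rhs => rw [← map_sphereIso_sphereMeasure L]
  rw [integral_map (continuous_sphereIso L).aemeasurable hg.aestronglyMeasurable]

theorem mobius_map (L : E3 ≃ₗᵢ[ℝ] E3) (x z : E3) : mobius (L x) (L z) = L (mobius x z) := by
  simp [mobius, L.inner_map_map, L.norm_map]

theorem norm_sq_E3 (x : E3) : ‖x‖ ^ 2 = x 0 ^ 2 + x 1 ^ 2 + x 2 ^ 2 := by
  rw [EuclideanSpace.norm_sq_eq]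
  simp [Fin.sum_univ_three]

theorem inner_E3 (x y : E3) : inner ℝ x y = x 0 * y 0 + x 1 * y 1 + x 2 * y 2 := by
  rw [PiLp.inner_apply]
  simp [Fin.sum_univ_three, mul_comm]

theorem ext_E3 {x y : E3} (h0 : x 0 = y 0) (h1 : x 1 = y 1) (h2 : x 2 = y 2) : x = y := by
  ext i
  fin_cases i <;> assumption

/-- The linear isometry of `ℝ³` with a given orthogonal matrix. -/
def orthoIso (A : Matrix (Fin 3) (Fin 3) ℝ) (hA : A.transpose * A = 1) : E3 ≃ₗᵢ[ℝ] E3 :=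
  LinearIsometry.toLinearIsometryEquiv
    { toLinearMap := Matrix.toLpLin 2 2 A
      norm_map' := fun x => by
        rw [← Real.sqrt_sq (norm_nonneg x), ← Real.sqrt_sq (norm_nonneg (Matrix.toLpLin 2 2 A x)),
          ← real_inner_self_eq_norm_sq, ← real_inner_self_eq_norm_sq]
        congr 1
        rw [EuclideanSpace.inner_eq_star_dotProduct, EuclideanSpace.inner_eq_star_dotProduct]
        simp only [star_trivial, Matrix.ofLp_toLpLin, Matrix.toLin'_apply]
        rw [Matrix.dotProduct_mulVec, Matrix.vecMul_mulVec, ← Matrix.dotProduct_mulVec, hA,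
          Matrix.one_mulVec] } rfl

theorem orthoIso_apply (A : Matrix (Fin 3) (Fin 3) ℝ) (hA : A.transpose * A = 1) (x : E3)
    (i : Fin 3) : orthoIso A hA x i = A i 0 * x 0 + A i 1 * x 1 + A i 2 * x 2 := by
  change Matrix.toLpLin 2 2 A x i = _
  simp [Matrix.toLpLin_apply, Matrix.mulVec, dotProduct, Fin.sum_univ_three]

/-- The rotation by the angle `θ` about the vertical axis. -/
def axisRotation (θ : ℝ) : E3 ≃ₗᵢ[ℝ] E3 :=
  orthoIso !![Real.cos θ, -Real.sin θ, 0; Real.sin θ, Real.cos θ, 0; 0, 0, 1] (by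
    have h := Real.sin_sq_add_cos_sq θ
    ext i j
    fin_cases i <;> fin_cases j <;> simp [Matrix.mul_apply, Fin.sum_univ_three] <;> linarith)

/-- The rotation with cosine `c` and sine `s` in the plane of the first and third coordinates. -/
def tilt (c s : ℝ) (h : c ^ 2 + s ^ 2 = 1) : E3 ≃ₗᵢ[ℝ] E3 :=
  orthoIso !![c, 0, -s; 0, 1, 0; s, 0, c] (by
    ext i j
    fin_cases i <;> fin_cases j <;> simp [Matrix.mul_apply, Fin.sum_univ_three] <;> linarith)

/-- The reflection that changes signs of coordinates. -/
def signIso (e₀ e₁ e₂ : ℝ) (h₀ : e₀ * e₀ = 1) (h₁ : e₁ * e₁ = 1) (h₂ : e₂ * e₂ = 1) :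
    E3 ≃ₗᵢ[ℝ] E3 :=
  orthoIso !![e₀, 0, 0; 0, e₁, 0; 0, 0, e₂] (by
    ext i j
    fin_cases i <;> fin_cases j <;> simp [Matrix.mul_apply, Fin.sum_univ_three, *])

theorem axisRotation_zero (θ : ℝ) (x : E3) :
    axisRotation θ x 0 = Real.cos θ * x 0 - Real.sin θ * x 1 := by
  simp [axisRotation, orthoIso_apply]; ring

theorem axisRotation_one (θ : ℝ) (x : E3) :
    axisRotation θ x 1 = Real.sin θ * x 0 + Real.cos θ * x 1 := by
  simp [axisRotation, orthoIso_apply]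

theorem axisRotation_two (θ : ℝ) (x : E3) : axisRotation θ x 2 = x 2 := by
  simp [axisRotation, orthoIso_apply]

theorem tilt_zero {c s : ℝ} (h : c ^ 2 + s ^ 2 = 1) (x : E3) :
    tilt c s h x 0 = c * x 0 - s * x 2 := by
  simp [tilt, orthoIso_apply]; ring

theorem tilt_one {c s : ℝ} (h : c ^ 2 + s ^ 2 = 1) (x : E3) : tilt c s h x 1 = x 1 := by
  simp [tilt, orthoIso_apply]

theorem tilt_two {c s : ℝ} (h : c ^ 2 + s ^ 2 = 1) (x : E3) :
    tilt c s h x 2 = s * x 0 + c * x 2 := by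
  simp [tilt, orthoIso_apply]

theorem signIso_zero {e₀ e₁ e₂ : ℝ} (h₀ : e₀ * e₀ = 1) (h₁ : e₁ * e₁ = 1) (h₂ : e₂ * e₂ = 1)
    (x : E3) : signIso e₀ e₁ e₂ h₀ h₁ h₂ x 0 = e₀ * x 0 := by
  simp [signIso, orthoIso_apply]

theorem signIso_one {e₀ e₁ e₂ : ℝ} (h₀ : e₀ * e₀ = 1) (h₁ : e₁ * e₁ = 1) (h₂ : e₂ * e₂ = 1)
    (x : E3) : signIso e₀ e₁ e₂ h₀ h₁ h₂ x 1 = e₁ * x 1 := by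
  simp [signIso, orthoIso_apply]

theorem signIso_two {e₀ e₁ e₂ : ℝ} (h₀ : e₀ * e₀ = 1) (h₁ : e₁ * e₁ = 1) (h₂ : e₂ * e₂ = 1)
    (x : E3) : signIso e₀ e₁ e₂ h₀ h₁ h₂ x 2 = e₂ * x 2 := by
  simp [signIso, orthoIso_apply]

/-! ### The squaring map in coordinates -/

theorem riemannSphere_symm_of_ne {ζ : S2} (h : ζ ≠ northPole) :
    riemannSphere.symm ζ =
      ((⟨ζ.1 0 / (1 - ζ.1 2), ζ.1 1 / (1 - ζ.1 2)⟩ : ℂ) : OnePoint ℂ) := by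
  change (if ζ = northPole then OnePoint.infty else _) = _
  rw [if_neg h]

theorem riemannSphere_infty : riemannSphere OnePoint.infty = northPole := rfl

theorem riemannSphere_coe (z : ℂ) : riemannSphere (z : OnePoint ℂ) = stereo z := rfl

theorem squareMap_northPole : squareMap northPole = northPole := by
  rw [squareMap, ← riemannSphere_infty, Equiv.symm_apply_apply]
  rfl

theorem apply_two_lt_one {ζ : S2} (h : ζ ≠ northPole) : ζ.1 2 < 1 := by
  have hs := sum_sq_eq_one ζ
  by_contra hcon
  apply h
  have e2 : ζ.1 2 = 1 := by nlinarith [sq_nonneg (ζ.1 0), sq_nonneg (ζ.1 1)]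
  have e0 : ζ.1 0 = 0 := by nlinarith [sq_nonneg (ζ.1 0), sq_nonneg (ζ.1 1)]
  have e1 : ζ.1 1 = 0 := by nlinarith [sq_nonneg (ζ.1 0), sq_nonneg (ζ.1 1)]
  apply Subtype.ext
  apply ext_E3 <;> simp [northPole, e0, e1, e2]

theorem squareMap_coe (ζ : S2) :
    (squareMap ζ : E3) = !₂[(ζ.1 0 ^ 2 - ζ.1 1 ^ 2) / (1 + ζ.1 2 ^ 2),
      2 * ζ.1 0 * ζ.1 1 / (1 + ζ.1 2 ^ 2), 2 * ζ.1 2 / (1 + ζ.1 2 ^ 2)] := by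
  by_cases hN : ζ = northPole
  · rw [hN, squareMap_northPole]
    apply ext_E3 <;> simp only [northPole, Matrix.cons_val] <;> norm_num
  · have hlt := apply_two_lt_one hN
    have hs := sum_sq_eq_one ζ
    rw [squareMap, riemannSphere_symm_of_ne hN, OnePoint.map_some, riemannSphere_coe]
    generalize ζ.1 0 = a at *
    generalize ζ.1 1 = b at *
    generalize ζ.1 2 = c at *
    have h1 : 1 - c ≠ 0 := by linarith
    have h2 : 1 + c ^ 2 ≠ 0 := by positivity
    have hre : ((⟨a / (1 - c), b / (1 - c)⟩ : ℂ) ^ 2).re = (a ^ 2 - b ^ 2) / (1 - c) ^ 2 := by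
      rw [sq, Complex.mul_re]; field_simp
    have him : ((⟨a / (1 - c), b / (1 - c)⟩ : ℂ) ^ 2).im = 2 * a * b / (1 - c) ^ 2 := by
      rw [sq, Complex.mul_im]; field_simp; ring
    have hn : ‖(⟨a / (1 - c), b / (1 - c)⟩ : ℂ) ^ 2‖ ^ 2 = (1 + c) ^ 2 / (1 - c) ^ 2 := by
      rw [← Complex.normSq_eq_norm_sq, Complex.normSq_apply, hre, him]
      have : a ^ 2 = 1 - b ^ 2 - c ^ 2 := by linarith
      field_simp
      have h4 : a ^ 4 = (1 - b ^ 2 - c ^ 2) ^ 2 := by rw [← this]; ring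
      ring_nf
      rw [h4, this]
      ring
    have h3 : 1 + (1 + c) ^ 2 / (1 - c) ^ 2 = 2 * (1 + c ^ 2) / (1 - c) ^ 2 := by
      field_simp; ring
    apply ext_E3
    · simp only [stereo, Matrix.cons_val]
      rw [hn, hre, h3]; field_simp
    · simp only [stereo, Matrix.cons_val]
      rw [hn, him, h3]; field_simp
    · simp only [stereo, Matrix.cons_val]
      rw [hn, add_comm _ (1 : ℝ), h3]; field_simp; ring

theorem squareMap_zero (ζ : S2) :
    (squareMap ζ : E3) 0 = (ζ.1 0 ^ 2 - ζ.1 1 ^ 2) / (1 + ζ.1 2 ^ 2) := by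
  rw [squareMap_coe]; rfl

theorem squareMap_one (ζ : S2) :
    (squareMap ζ : E3) 1 = 2 * ζ.1 0 * ζ.1 1 / (1 + ζ.1 2 ^ 2) := by
  rw [squareMap_coe]; rfl

theorem squareMap_two (ζ : S2) : (squareMap ζ : E3) 2 = 2 * ζ.1 2 / (1 + ζ.1 2 ^ 2) := by
  rw [squareMap_coe]; rfl

theorem continuous_squareMap : Continuous squareMap := by
  rw [continuous_induced_rng]
  have : (Subtype.val ∘ squareMap) = fun ζ : S2 =>
      !₂[(ζ.1 0 ^ 2 - ζ.1 1 ^ 2) / (1 + ζ.1 2 ^ 2),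
      2 * ζ.1 0 * ζ.1 1 / (1 + ζ.1 2 ^ 2), 2 * ζ.1 2 / (1 + ζ.1 2 ^ 2)] :=
    funext squareMap_coe
  rw [this]
  refine (PiLp.continuous_toLp 2 _).comp (continuous_pi fun i => ?_)
  have h (ζ : S2) : 1 + ζ.1 2 ^ 2 ≠ 0 := by positivity
  fin_cases i
  all_goals
    simp only [Fin.zero_eta, Fin.mk_one, Fin.reduceFinMk, Matrix.cons_val]
    fun_prop (disch := assumption)

theorem squareMap_surjective : Function.Surjective squareMap := by
  intro ζ
  obtain ⟨p, rfl⟩ := riemannSphere.surjective ζ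
  induction p using OnePoint.rec with
  | infty => exact ⟨northPole, squareMap_northPole⟩
  | coe z =>
    obtain ⟨w, hw⟩ := IsAlgClosed.exists_pow_nat_eq z two_pos
    refine ⟨riemannSphere w, ?_⟩
    rw [squareMap, Equiv.symm_apply_apply, OnePoint.map_some, hw]

end BaryExt
end

noncomputable section
namespace BaryExt

/-! ### The isometries in coordinates -/

theorem mobius_apply_of_norm_eq_one (x : E3) {z : E3} (hz : ‖z‖ = 1) (i : Fin 3) :
    mobius x z i = ((1 - ‖x‖ ^ 2) * z i + 2 * (1 + inner ℝ x z) * x i) /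
      (1 + ‖x‖ ^ 2 + 2 * inner ℝ x z) := by
  simp only [mobius, hz, PiLp.smul_apply, PiLp.add_apply, smul_eq_mul]
  rw [div_eq_inv_mul]
  ring

theorem mobius_horizontal (τ : ℝ) {z : E3} (hz : ‖z‖ = 1) :
    mobius !₂[τ, 0, 0] z = !₂[((1 + τ ^ 2) * z 0 + 2 * τ) / (1 + τ ^ 2 + 2 * τ * z 0),
      (1 - τ ^ 2) * z 1 / (1 + τ ^ 2 + 2 * τ * z 0),
      (1 - τ ^ 2) * z 2 / (1 + τ ^ 2 + 2 * τ * z 0)] := by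
  apply ext_E3 <;>
  · rw [mobius_apply_of_norm_eq_one _ hz, norm_sq_E3, inner_E3]
    simp only [Matrix.cons_val]
    congr 1 <;> ring

theorem mobius_vertical (t : ℝ) {z : E3} (hz : ‖z‖ = 1) :
    mobius !₂[0, 0, t] z = !₂[(1 - t ^ 2) * z 0 / (1 + t ^ 2 + 2 * t * z 2),
      (1 - t ^ 2) * z 1 / (1 + t ^ 2 + 2 * t * z 2),
      ((1 + t ^ 2) * z 2 + 2 * t) / (1 + t ^ 2 + 2 * t * z 2)] := by
  apply ext_E3 <;>
  · rw [mobius_apply_of_norm_eq_one _ hz, norm_sq_E3, inner_E3]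
    simp only [Matrix.cons_val]
    congr 1 <;> ring

theorem abs_apply_le_one {z : E3} (hz : ‖z‖ = 1) (i : Fin 3) : |z i| ≤ 1 := by
  rw [← hz]; exact PiLp.norm_apply_le z i

theorem one_add_sq_add_pos {t u : ℝ} (ht : |t| < 1) (hu : |u| ≤ 1) :
    0 < 1 + t ^ 2 + 2 * t * u := by
  have h : |t * u| < 1 := by
    rw [abs_mul]; nlinarith [abs_nonneg t, abs_nonneg u]
  have h2 : |t * u| ≤ |t| := by rw [abs_mul]; nlinarith [abs_nonneg t]
  have := neg_abs_le (t * u)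
  nlinarith [sq_abs t, sq_nonneg (1 - |t|)]

theorem mobius_vertical_horizontal (τ t : ℝ) :
    mobius !₂[0, 0, t] !₂[τ, 0, 0] = !₂[τ * (1 - t ^ 2) / (1 + t ^ 2 * τ ^ 2), 0,
      t * (1 + τ ^ 2) / (1 + t ^ 2 * τ ^ 2)] := by
  apply ext_E3 <;>
  · simp only [mobius, norm_sq_E3, inner_E3, PiLp.smul_apply, PiLp.add_apply, smul_eq_mul,
      Matrix.cons_val]
    ring_nf

theorem tilt_aux (τ t : ℝ) : ((1 - t ^ 2 * τ ^ 2) / (1 + t ^ 2 * τ ^ 2)) ^ 2 +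
    (2 * t * τ / (1 + t ^ 2 * τ ^ 2)) ^ 2 = 1 := by
  have : 1 + t ^ 2 * τ ^ 2 ≠ 0 := by positivity
  field_simp
  ring

/-- The composition of two translations along orthogonal geodesics is a translation up to a
rotation. -/
theorem mobius_mobius_tilt {τ t : ℝ} (hτ : |τ| < 1) (ht : |t| < 1) {z : E3} (hz : ‖z‖ = 1)
    (hM : ‖mobius !₂[τ, 0, 0] z‖ = 1) :
    mobius (mobius !₂[0, 0, t] !₂[τ, 0, 0]) (tilt _ _ (tilt_aux τ t) z) =
      mobius !₂[0, 0, t] (mobius !₂[τ, 0, 0] z) := by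
  have hz' : ‖tilt _ _ (tilt_aux τ t) z‖ = 1 := by rw [LinearIsometryEquiv.norm_map, hz]
  have hp1 := one_add_sq_add_pos hτ (abs_apply_le_one hz 0)
  have hp2 := one_add_sq_add_pos ht (abs_apply_le_one hM 2)
  have he : 0 < 1 + t ^ 2 * τ ^ 2 := by positivity
  have hτ2 : 0 < 1 - τ ^ 2 := by nlinarith [sq_abs τ, abs_nonneg τ]
  have ht2 : 0 < 1 - t ^ 2 := by nlinarith [sq_abs t, abs_nonneg t]
  have hn : ‖(!₂[τ * (1 - t ^ 2) / (1 + t ^ 2 * τ ^ 2), 0,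
      t * (1 + τ ^ 2) / (1 + t ^ 2 * τ ^ 2)] : E3)‖ ^ 2 =
      1 - (1 - τ ^ 2) * (1 - t ^ 2) / (1 + t ^ 2 * τ ^ 2) := by
    rw [norm_sq_E3]
    simp only [Matrix.cons_val]
    field_simp
    ring
  have hk : inner ℝ (!₂[τ * (1 - t ^ 2) / (1 + t ^ 2 * τ ^ 2), 0,
      t * (1 + τ ^ 2) / (1 + t ^ 2 * τ ^ 2)] : E3) (tilt _ _ (tilt_aux τ t) z) =
      (τ * (1 + t ^ 2) * z 0 + t * (1 - τ ^ 2) * z 2) / (1 + t ^ 2 * τ ^ 2) := by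
    rw [inner_E3]
    simp only [Matrix.cons_val, tilt_zero, tilt_one, tilt_two]
    field_simp
    ring
  rw [mobius_horizontal _ hz] at hM hp2 ⊢
  rw [mobius_vertical _ hM, mobius_vertical_horizontal]
  simp only [Matrix.cons_val] at hp2
  have hE : (1 + t ^ 2) * (1 + τ ^ 2 + 2 * τ * z 0) + 2 * t * (1 - τ ^ 2) * z 2 ≠ 0 := by
    have : 1 + t ^ 2 + 2 * t * ((1 - τ ^ 2) * z 2 / (1 + τ ^ 2 + 2 * τ * z 0)) =
      ((1 + t ^ 2) * (1 + τ ^ 2 + 2 * τ * z 0) + 2 * t * (1 - τ ^ 2) * z 2) /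
        (1 + τ ^ 2 + 2 * τ * z 0) := by
      field_simp
    rw [this] at hp2
    exact fun h => by simp [h] at hp2
  have hden1 : 1 + (1 - (1 - τ ^ 2) * (1 - t ^ 2) / (1 + t ^ 2 * τ ^ 2)) +
      2 * ((τ * (1 + t ^ 2) * z 0 + t * (1 - τ ^ 2) * z 2) / (1 + t ^ 2 * τ ^ 2)) =
      ((1 + t ^ 2) * (1 + τ ^ 2 + 2 * τ * z 0) + 2 * t * (1 - τ ^ 2) * z 2) /
        (1 + t ^ 2 * τ ^ 2) := by
    field_simp
    ring
  have hden2 : 1 + t ^ 2 + 2 * t * ((1 - τ ^ 2) * z 2 / (1 + τ ^ 2 + 2 * τ * z 0)) =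
      ((1 + t ^ 2) * (1 + τ ^ 2 + 2 * τ * z 0) + 2 * t * (1 - τ ^ 2) * z 2) /
        (1 + τ ^ 2 + 2 * τ * z 0) := by
    field_simp
  apply ext_E3 <;>
  · rw [mobius_apply_of_norm_eq_one _ hz', hn, hk]
    simp only [Matrix.cons_val, tilt_zero, tilt_one, tilt_two]
    rw [hden1, hden2, div_div_eq_mul_div, div_div_eq_mul_div]
    congr 1
    generalize hD : 1 + τ ^ 2 + 2 * τ * z 0 = D at *
    field_simp
    try rw [← hD]
    ring

theorem coe_polar_zero (r : ℝ) : (polar r 0 : E3) = !₂[Real.tanh (r / 2), 0, 0] := by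
  simp [polar]

theorem coe_axisPoint (h : ℝ) : (axisPoint h : E3) = !₂[0, 0, Real.tanh (h / 2)] := rfl

theorem coe_mobiusSphere (x : H3) (ζ : S2) : (mobiusSphere x ζ : E3) = mobius x ζ := rfl

theorem coe_mobiusBall (x z : H3) : (mobiusBall x z : E3) = mobius x z := rfl

theorem coe_sphereIso (L : E3 ≃ₗᵢ[ℝ] E3) (ζ : S2) : (sphereIso L ζ : E3) = L ζ := rfl

theorem coe_ballIso (L : E3 ≃ₗᵢ[ℝ] E3) (ζ : H3) : (ballIso L ζ : E3) = L ζ := rfl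

theorem exists_gyration (r h : ℝ) : ∃ L : E3 ≃ₗᵢ[ℝ] E3, ∀ ζ : S2,
    mobiusSphere (cylindrical r 0 h) (sphereIso L ζ) =
      mobiusSphere (axisPoint h) (mobiusSphere (polar r 0) ζ) := by
  refine ⟨tilt _ _ (tilt_aux (Real.tanh (r / 2)) (Real.tanh (h / 2))), fun ζ => Subtype.ext ?_⟩
  have hM := norm_sphere (mobiusSphere (polar r 0) ζ)
  rw [coe_mobiusSphere, coe_polar_zero] at hM
  rw [coe_mobiusSphere, coe_mobiusSphere, coe_mobiusSphere, coe_sphereIso, cylindrical,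
    coe_mobiusBall, coe_axisPoint, coe_polar_zero]
  exact mobius_mobius_tilt (Real.abs_tanh_lt_one _) (Real.abs_tanh_lt_one _) (norm_sphere ζ) hM

theorem mobiusSphere_ballIso (L : E3 ≃ₗᵢ[ℝ] E3) (x : H3) (ζ : S2) :
    mobiusSphere (ballIso L x) (sphereIso L ζ) = sphereIso L (mobiusSphere x ζ) :=
  Subtype.ext (mobius_map L x ζ)

theorem mobiusBall_ballIso (L : E3 ≃ₗᵢ[ℝ] E3) (x z : H3) :
    mobiusBall (ballIso L x) (ballIso L z) = ballIso L (mobiusBall x z) :=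
  Subtype.ext (mobius_map L x z)

theorem ballIso_neg (L : E3 ≃ₗᵢ[ℝ] E3) (x : H3) : ballIso L (-x) = -ballIso L x :=
  Subtype.ext (L.map_neg x)

theorem cylindrical_eq_ballIso (r θ h : ℝ) :
    cylindrical r θ h = ballIso (axisRotation θ) (cylindrical r 0 h) := by
  have h1 : axisPoint h = ballIso (axisRotation θ) (axisPoint h) := by
    apply Subtype.ext
    apply ext_E3 <;>
      simp [coe_ballIso, coe_axisPoint, axisRotation_zero, axisRotation_one, axisRotation_two]
  have h2 : polar r θ = ballIso (axisRotation θ) (polar r 0) := by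
    apply Subtype.ext
    apply ext_E3 <;>
      simp [coe_ballIso, polar, axisRotation_zero, axisRotation_one, axisRotation_two, mul_comm]
  rw [cylindrical, cylindrical, ← mobiusBall_ballIso, ← h1, ← h2]

/-! ### Equivariance of the squaring map -/

theorem squareMap_axisRotation (θ : ℝ) (ζ : S2) :
    squareMap (sphereIso (axisRotation θ) ζ) =
      sphereIso (axisRotation (2 * θ)) (squareMap ζ) := by
  apply Subtype.ext
  apply ext_E3
  · rw [coe_sphereIso, axisRotation_zero, squareMap_zero, squareMap_zero, squareMap_one]
    simp only [coe_sphereIso, axisRotation_zero, axisRotation_one, axisRotation_two,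
      Real.cos_two_mul', Real.sin_two_mul]
    ring
  · rw [coe_sphereIso, axisRotation_one, squareMap_one, squareMap_zero, squareMap_one]
    simp only [coe_sphereIso, axisRotation_zero, axisRotation_one, axisRotation_two,
      Real.cos_two_mul', Real.sin_two_mul]
    ring
  · rw [coe_sphereIso, axisRotation_two, squareMap_two, squareMap_two]
    simp only [coe_sphereIso, axisRotation_two]

theorem tanh_eq_half (h : ℝ) :
    Real.tanh h = 2 * Real.tanh (h / 2) / (1 + Real.tanh (h / 2) ^ 2) := by
  have h1 : h = 2 * (h / 2) := by ring
  conv_lhs => rw [h1]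
  rw [Real.tanh_eq_sinh_div_cosh, Real.tanh_eq_sinh_div_cosh, Real.sinh_two_mul,
    Real.cosh_two_mul]
  have := Real.cosh_pos (h / 2)
  field_simp

theorem squareMap_mobiusSphere_axisPoint (h : ℝ) (ζ : S2) :
    squareMap (mobiusSphere (axisPoint h) ζ) =
      mobiusSphere (axisPoint (2 * h)) (squareMap ζ) := by
  have hz := norm_sphere ζ
  have hM := norm_sphere (mobiusSphere (axisPoint h) ζ)
  have hf := norm_sphere (squareMap ζ)
  have hp := one_add_sq_add_pos (Real.abs_tanh_lt_one (h / 2)) (abs_apply_le_one hz 2)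
  have hp2 := one_add_sq_add_pos (Real.abs_tanh_lt_one h) (abs_apply_le_one hf 2)
  have hc : (mobiusSphere (axisPoint h) ζ : E3) = _ := mobius_vertical _ hz
  have h2 : 2 * h / 2 = h := by ring
  apply Subtype.ext
  have hr : (mobiusSphere (axisPoint (2 * h)) (squareMap ζ) : E3) = _ := mobius_vertical _ hf
  rw [squareMap_coe, hr, hc]
  simp only [Matrix.cons_val, h2, squareMap_zero, squareMap_one, squareMap_two] at hp2 ⊢
  rw [tanh_eq_half h] at hp2 ⊢
  generalize Real.tanh (h / 2) = t at *
  generalize ζ.1 0 = a at *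
  generalize ζ.1 1 = b at *
  generalize ζ.1 2 = c at *
  have he : 0 < 1 + t ^ 2 := by positivity
  have hc2 : 0 < 1 + c ^ 2 := by positivity
  have hd1 : 1 + (2 * t / (1 + t ^ 2)) ^ 2 + 2 * (2 * t / (1 + t ^ 2)) * (2 * c / (1 + c ^ 2)) =
      ((1 + t ^ 2 + 2 * t * c) ^ 2 + ((1 + t ^ 2) * c + 2 * t) ^ 2) /
        ((1 + t ^ 2) ^ 2 * (1 + c ^ 2)) := by
    field_simp
    ring
  have hd2 : 1 + (((1 + t ^ 2) * c + 2 * t) / (1 + t ^ 2 + 2 * t * c)) ^ 2 =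
      ((1 + t ^ 2 + 2 * t * c) ^ 2 + ((1 + t ^ 2) * c + 2 * t) ^ 2) /
        (1 + t ^ 2 + 2 * t * c) ^ 2 := by
    generalize 1 + t ^ 2 + 2 * t * c = D at *
    field_simp
  rw [hd1, hd2]
  have hE : 0 < (1 + t ^ 2 + 2 * t * c) ^ 2 + ((1 + t ^ 2) * c + 2 * t) ^ 2 := by positivity
  apply ext_E3 <;>
  · simp only [Matrix.cons_val]
    rw [div_div_eq_mul_div, div_div_eq_mul_div]
    congr 1
    generalize hD : 1 + t ^ 2 + 2 * t * c = D at *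
    field_simp
    try rw [← hD]
    try ring

/-! ### Reduction to one coordinate -/

theorem isBalancedAt_map_iff {g : S2 → S2} (hg : Continuous g) (y : H3) :
    IsBalancedAt (sphereMeasure.map g) y ↔
      ∫ ζ, (mobiusSphere (-y) (g ζ) : E3) ∂sphereMeasure = 0 := by
  have hc := continuous_mobiusSphere (-y)
  rw [IsBalancedAt, IsBalanced, Measure.map_map hc.measurable hg.measurable,
    integral_map (hc.comp hg).aemeasurable continuous_subtype_val.aestronglyMeasurable]
  rfl

theorem isBalancedAt_cylindrical {r s : ℝ}
    (hb : IsBalancedAt (sphereMeasure.map (squareMap ∘ mobiusSphere (polar r 0))) (polar s 0))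
    (θ h : ℝ) :
    IsBalancedAt (sphereMeasure.map (squareMap ∘ mobiusSphere (cylindrical r θ h)))
      (cylindrical s (2 * θ) (2 * h)) := by
  have hc (x : H3) : Continuous (squareMap ∘ mobiusSphere x) :=
    continuous_squareMap.comp (continuous_mobiusSphere x)
  rw [isBalancedAt_map_iff (hc _)] at hb ⊢
  obtain ⟨L, hL⟩ := exists_gyration r h
  obtain ⟨L', hL'⟩ := exists_gyration s (2 * h)
  have hL2 (η : S2) : mobiusSphere (-cylindrical s 0 (2 * h)) (mobiusSphere (axisPoint (2 * h)) η)
      = sphereIso L' (mobiusSphere (-polar s 0) η) := by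
    have := hL' (mobiusSphere (-polar s 0) η)
    rw [mobiusSphere_mobiusSphere_neg] at this
    rw [← this, mobiusSphere_neg_mobiusSphere]
  have key (ζ : S2) : mobiusSphere (-cylindrical s (2 * θ) (2 * h))
      ((squareMap ∘ mobiusSphere (cylindrical r θ h))
        (sphereIso (axisRotation θ) (sphereIso L ζ))) =
      sphereIso (axisRotation (2 * θ)) (sphereIso L'
        (mobiusSphere (-polar s 0) ((squareMap ∘ mobiusSphere (polar r 0)) ζ))) := by
    simp only [Function.comp]
    rw [cylindrical_eq_ballIso r, mobiusSphere_ballIso, hL, squareMap_axisRotation,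
      squareMap_mobiusSphere_axisPoint, cylindrical_eq_ballIso s (2 * θ), ← ballIso_neg,
      mobiusSphere_ballIso, hL2]
  have hcont : Continuous fun ζ : S2 => (mobiusSphere (-cylindrical s (2 * θ) (2 * h))
      ((squareMap ∘ mobiusSphere (cylindrical r θ h)) ζ) : E3) :=
    continuous_subtype_val.comp ((continuous_mobiusSphere _).comp (hc _))
  have h2 := integral_comp_sphereIso L (hcont.comp (continuous_sphereIso (axisRotation θ)))
  rw [← integral_comp_sphereIso (axisRotation θ) hcont]
  simp only [Function.comp_def] at key hb h2 ⊢
  rw [← h2]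
  simp_rw [key, coe_sphereIso]
  have hi : Integrable (fun ζ : S2 => (mobiusSphere (-polar s 0)
      (squareMap (mobiusSphere (polar r 0) ζ)) : E3)) sphereMeasure :=
    integrable_of_continuous_S2
      (continuous_subtype_val.comp ((continuous_mobiusSphere _).comp (hc _)))
  have := (((axisRotation (2 * θ)).toContinuousLinearEquiv :
    E3 →L[ℝ] E3).comp (L'.toContinuousLinearEquiv : E3 →L[ℝ] E3)).integral_comp_comm hi
  rw [hb, map_zero] at this
  exact this

end BaryExt
end

noncomputable section
namespace BaryExt

/-! ### The scalar equation for the barycenter -/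

/-- The denominator of `balanceKernel`. -/
def balanceDenom (T κ : ℝ) (ζ : S2) : ℝ :=
  (ζ.1 0 + T) ^ 2 + (1 - T ^ 2) * ζ.1 2 ^ 2 + κ * (1 - ζ.1 0 ^ 2)

/-- The integrand of the equation for the barycenter of `(f ∘ M_x)_* μ`, `x` on the first axis. -/
def balanceKernel (T κ : ℝ) (ζ : S2) : ℝ := κ * (1 - ζ.1 0 ^ 2) / balanceDenom T κ ζ

/-- The mean of `balanceKernel`; it is `1 / 2` at the barycenter. -/
def balanceMean (T κ : ℝ) : ℝ := ∫ ζ, balanceKernel T κ ζ ∂sphereMeasure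

theorem apply_sq_le_one (ζ : S2) (i : Fin 3) : ζ.1 i ^ 2 ≤ 1 := by
  have := abs_apply_le_one (norm_sphere ζ) i
  rw [← sq_abs]; nlinarith [abs_nonneg (ζ.1 i)]

theorem balanceDenom_pos {T κ : ℝ} (hT : |T| < 1) (hκ : 0 < κ) (ζ : S2) :
    0 < balanceDenom T κ ζ := by
  have ha := apply_sq_le_one ζ 0
  have hT' := abs_lt.1 hT
  have hT2 : 0 < 1 - T ^ 2 := by nlinarith
  rw [balanceDenom]
  rcases ha.lt_or_eq with h | h
  · have : 0 < κ * (1 - ζ.1 0 ^ 2) := mul_pos hκ (by linarith)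
    positivity
  · have h1 : 0 < (ζ.1 0 + T) ^ 2 := by
      refine sq_pos_of_ne_zero fun h0 => ?_
      have : ζ.1 0 = -T := by linarith
      rw [this] at h
      linarith
    rw [h]
    nlinarith [mul_nonneg hT2.le (sq_nonneg (ζ.1 2))]

theorem continuous_apply_S2 (i : Fin 3) : Continuous fun ζ : S2 => ζ.1 i :=
  (EuclideanSpace.proj i).continuous.comp continuous_subtype_val

theorem continuous_balanceKernel {T κ : ℝ} (hT : |T| < 1) (hκ : 0 < κ) :
    Continuous (balanceKernel T κ) := by
  have h0 := continuous_apply_S2 0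
  have h2 := continuous_apply_S2 2
  unfold balanceKernel
  refine Continuous.div (by fun_prop) (by unfold balanceDenom; fun_prop)
    fun ζ => (balanceDenom_pos hT hκ ζ).ne'

theorem tanh_half_eq (s : ℝ) : Real.tanh (s / 2) = (Real.exp s - 1) / (Real.exp s + 1) := by
  have h1 : Real.exp s = Real.exp (s / 2) ^ 2 := by rw [← Real.exp_nat_mul]; congr 1; ring
  rw [Real.tanh_eq, h1, Real.exp_neg]
  have := Real.exp_pos (s / 2)
  field_simp

theorem mobiusSphere_neg_polar_squareMap (s : ℝ) (η : S2) :
    (mobiusSphere (-polar s 0) (squareMap η) : E3) 0 =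
      1 - 2 * (Real.exp s ^ 2 * (1 - η.1 0 ^ 2) /
        (η.1 0 ^ 2 + η.1 2 ^ 2 + Real.exp s ^ 2 * (1 - η.1 0 ^ 2))) := by
  have hn := sum_sq_eq_one η
  have hf := norm_sphere (squareMap η)
  have hp := one_add_sq_add_pos (t := -Real.tanh (s / 2))
    (by rw [abs_neg]; exact Real.abs_tanh_lt_one _) (abs_apply_le_one hf 0)
  have hc : (mobiusSphere (-polar s 0) (squareMap η) : E3) =
      mobius !₂[-Real.tanh (s / 2), 0, 0] (squareMap η) := by
    rw [coe_mobiusSphere, coe_neg_H3, coe_polar_zero]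
    congr 1
    apply ext_E3 <;> simp
  rw [hc, mobius_horizontal _ hf]
  simp only [Matrix.cons_val]
  rw [squareMap_zero] at hp ⊢
  rw [tanh_half_eq] at hp ⊢
  have he := Real.exp_pos s
  generalize Real.exp s = e at *
  generalize η.1 0 = a at *
  generalize η.1 1 = b at *
  generalize η.1 2 = c at *
  have hb : b ^ 2 = 1 - a ^ 2 - c ^ 2 := by linarith
  have h1 : 0 < 1 + c ^ 2 := by positivity
  have h2 : 0 < e + 1 := by positivity
  have hden : 1 + (-((e - 1) / (e + 1))) ^ 2 + 2 * -((e - 1) / (e + 1)) *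
      ((a ^ 2 - b ^ 2) / (1 + c ^ 2)) =
      4 * (a ^ 2 + c ^ 2 + e ^ 2 * (1 - a ^ 2)) / ((e + 1) ^ 2 * (1 + c ^ 2)) := by
    rw [hb]; field_simp; ring
  rw [hden] at hp ⊢
  have hq : 0 < a ^ 2 + c ^ 2 + e ^ 2 * (1 - a ^ 2) := by
    by_contra hcon
    have : 4 * (a ^ 2 + c ^ 2 + e ^ 2 * (1 - a ^ 2)) / ((e + 1) ^ 2 * (1 + c ^ 2)) ≤ 0 :=
      div_nonpos_of_nonpos_of_nonneg (by linarith) (by positivity)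
    linarith
  rw [hb]
  generalize hQ : a ^ 2 + c ^ 2 + e ^ 2 * (1 - a ^ 2) = Q at *
  field_simp
  rw [← hQ]
  ring

theorem mobiusSphere_polar_apply (r : ℝ) (ζ : S2) :
    0 < 1 + Real.tanh r * ζ.1 0 ∧
    (mobiusSphere (polar r 0) ζ : E3) 0 = (ζ.1 0 + Real.tanh r) / (1 + Real.tanh r * ζ.1 0) ∧
    (mobiusSphere (polar r 0) ζ : E3) 2 ^ 2 =
      (1 - Real.tanh r ^ 2) * ζ.1 2 ^ 2 / (1 + Real.tanh r * ζ.1 0) ^ 2 := by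
  have hz := norm_sphere ζ
  have hp := one_add_sq_add_pos (Real.abs_tanh_lt_one (r / 2)) (abs_apply_le_one hz 0)
  have hc : (mobiusSphere (polar r 0) ζ : E3) = mobius !₂[Real.tanh (r / 2), 0, 0] ζ := by
    rw [coe_mobiusSphere, coe_polar_zero]
  rw [hc, mobius_horizontal _ hz]
  simp only [Matrix.cons_val]
  rw [tanh_eq_half r]
  generalize Real.tanh (r / 2) = t at *
  generalize ζ.1 0 = a at *
  generalize ζ.1 2 = c at *
  have h1 : 0 < 1 + t ^ 2 := by positivity
  have h2 : 1 + 2 * t / (1 + t ^ 2) * a = (1 + t ^ 2 + 2 * t * a) / (1 + t ^ 2) := by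
    field_simp
  rw [h2]
  generalize 1 + t ^ 2 + 2 * t * a = D at *
  refine ⟨by positivity, ?_, ?_⟩
  · field_simp
  · field_simp
    ring

theorem one_sub_tanh_sq (r : ℝ) : 1 - Real.tanh r ^ 2 = (Real.cosh r ^ 2)⁻¹ := by
  have h := Real.cosh_sq r
  have := Real.cosh_pos r
  rw [Real.tanh_eq_sinh_div_cosh, div_pow]
  field_simp
  linarith

theorem mobiusSphere_squareMap_mobiusSphere_apply_zero {r s κ : ℝ}
    (h : Real.exp s ^ 2 = κ * Real.cosh r ^ 2) (ζ : S2) :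
    (mobiusSphere (-polar s 0) (squareMap (mobiusSphere (polar r 0) ζ)) : E3) 0 =
      1 - 2 * balanceKernel (Real.tanh r) κ ζ := by
  obtain ⟨hp, h0, h2⟩ := mobiusSphere_polar_apply r ζ
  have hc := Real.cosh_pos r
  have hκ : 0 < κ := by
    have : 0 < κ * Real.cosh r ^ 2 := by rw [← h]; positivity
    exact pos_of_mul_pos_left this (by positivity)
  have hd := balanceDenom_pos (Real.abs_tanh_lt_one r) hκ ζ
  have hm : Real.exp s ^ 2 * (1 - Real.tanh r ^ 2) = κ := by
    rw [h, one_sub_tanh_sq]; field_simp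
  have hm2 : 1 - Real.tanh r ^ 2 ≠ 0 := by rw [one_sub_tanh_sq]; positivity
  rw [mobiusSphere_neg_polar_squareMap, balanceKernel]
  congr 2
  rw [h2, h0]
  rw [balanceDenom] at *
  generalize Real.tanh r = T at *
  generalize Real.exp s ^ 2 = E at *
  generalize ζ.1 0 = a at *
  generalize ζ.1 2 = c at *
  have e1 : 1 - ((a + T) / (1 + T * a)) ^ 2 =
      (1 - T ^ 2) * (1 - a ^ 2) / (1 + T * a) ^ 2 := by
    generalize hD : 1 + T * a = D at *
    field_simp
    rw [← hD]
    ring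
  have e2 : ((a + T) / (1 + T * a)) ^ 2 + (1 - T ^ 2) * c ^ 2 / (1 + T * a) ^ 2 +
      E * ((1 - T ^ 2) * (1 - a ^ 2) / (1 + T * a) ^ 2) =
      ((a + T) ^ 2 + (1 - T ^ 2) * c ^ 2 + κ * (1 - a ^ 2)) / (1 + T * a) ^ 2 := by
    rw [← hm]; field_simp
  rw [e1, e2, ← mul_div_assoc, div_div_div_cancel_right₀ (by positivity), ← mul_assoc, hm]

theorem map_integral_mobiusSphere_squareMap {r s : ℝ} (L : E3 ≃ₗᵢ[ℝ] E3)
    (hr : ballIso L (polar r 0) = polar r 0) (hs : ballIso L (polar s 0) = polar s 0)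
    (hf : ∀ ζ, squareMap (sphereIso L ζ) = sphereIso L (squareMap ζ)) :
    L (∫ ζ, (mobiusSphere (-polar s 0) (squareMap (mobiusSphere (polar r 0) ζ)) : E3)
      ∂sphereMeasure) =
    ∫ ζ, (mobiusSphere (-polar s 0) (squareMap (mobiusSphere (polar r 0) ζ)) : E3)
      ∂sphereMeasure := by
  have hc : Continuous fun ζ : S2 =>
      (mobiusSphere (-polar s 0) (squareMap (mobiusSphere (polar r 0) ζ)) : E3) :=
    continuous_subtype_val.comp ((continuous_mobiusSphere _).comp
      (continuous_squareMap.comp (continuous_mobiusSphere _)))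
  have h1 := (L.toContinuousLinearEquiv : E3 →L[ℝ] E3).integral_comp_comm
    (integrable_of_continuous_S2 (μ := sphereMeasure) hc)
  have h2 := integral_comp_sphereIso L hc
  refine h1.symm.trans (Eq.trans ?_ h2)
  refine integral_congr_ae (ae_of_all _ fun ζ => ?_)
  have h3 : mobiusSphere (polar r 0) (sphereIso L ζ) =
      sphereIso L (mobiusSphere (polar r 0) ζ) := by
    rw [← mobiusSphere_ballIso, hr]
  have h4 (η : S2) : mobiusSphere (-polar s 0) (sphereIso L η) =
      sphereIso L (mobiusSphere (-polar s 0) η) := by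
    rw [← mobiusSphere_ballIso, ballIso_neg, hs]
  simp only [h3, hf, h4]
  rfl

theorem ballIso_signIso_polar {e₁ e₂ : ℝ} (h₁ : e₁ * e₁ = 1) (h₂ : e₂ * e₂ = 1) (r : ℝ) :
    ballIso (signIso 1 e₁ e₂ (one_mul 1) h₁ h₂) (polar r 0) = polar r 0 := by
  apply Subtype.ext
  rw [coe_ballIso, coe_polar_zero]
  apply ext_E3 <;> simp [signIso_zero, signIso_one, signIso_two]

theorem squareMap_signIso {e₁ e₂ : ℝ} (h₁ : e₁ * e₁ = 1) (h₂ : e₂ * e₂ = 1) (ζ : S2) :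
    squareMap (sphereIso (signIso 1 e₁ e₂ (one_mul 1) h₁ h₂) ζ) =
      sphereIso (signIso 1 e₁ e₂ (one_mul 1) h₁ h₂) (squareMap ζ) := by
  have h1 : e₁ ^ 2 = 1 := by rw [sq, h₁]
  have h2 : e₂ ^ 2 = 1 := by rw [sq, h₂]
  apply Subtype.ext
  apply ext_E3
  · rw [coe_sphereIso, signIso_zero, squareMap_zero, squareMap_zero]
    simp only [coe_sphereIso, signIso_zero, signIso_one, signIso_two, mul_pow, h1, h2]
    ring
  · rw [coe_sphereIso, signIso_one, squareMap_one, squareMap_one]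
    simp only [coe_sphereIso, signIso_zero, signIso_one, signIso_two, mul_pow, h2]
    ring
  · rw [coe_sphereIso, signIso_two, squareMap_two, squareMap_two]
    simp only [coe_sphereIso, signIso_two, mul_pow, h2]
    ring

theorem isBalancedAt_polar {r s κ : ℝ} (h : Real.exp s ^ 2 = κ * Real.cosh r ^ 2)
    (hK : balanceMean (Real.tanh r) κ = 1 / 2) :
    IsBalancedAt (sphereMeasure.map (squareMap ∘ mobiusSphere (polar r 0))) (polar s 0) := by
  have hc : Continuous (squareMap ∘ mobiusSphere (polar r 0)) :=
    continuous_squareMap.comp (continuous_mobiusSphere _)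
  have hg : Continuous fun ζ : S2 =>
      (mobiusSphere (-polar s 0) (squareMap (mobiusSphere (polar r 0) ζ)) : E3) :=
    continuous_subtype_val.comp ((continuous_mobiusSphere _).comp hc)
  have hκ : 0 < κ := by
    have := Real.cosh_pos r
    have : 0 < κ * Real.cosh r ^ 2 := by rw [← h]; positivity
    exact pos_of_mul_pos_left this (by positivity)
  rw [isBalancedAt_map_iff hc]
  apply ext_E3
  · have h1 := (EuclideanSpace.proj (𝕜 := ℝ) (0 : Fin 3)).integral_comp_comm
      (integrable_of_continuous_S2 (μ := sphereMeasure) hg)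
    refine h1.symm.trans ?_
    have h2 (ζ : S2) : EuclideanSpace.proj (𝕜 := ℝ) (0 : Fin 3)
        (mobiusSphere (-polar s 0) (squareMap (mobiusSphere (polar r 0) ζ)) : E3) =
        1 - 2 * balanceKernel (Real.tanh r) κ ζ :=
      mobiusSphere_squareMap_mobiusSphere_apply_zero h ζ
    simp_rw [h2]
    have h3 := continuous_balanceKernel (Real.abs_tanh_lt_one r) hκ
    rw [integral_sub (integrable_const _) (integrable_of_continuous_S2 (by fun_prop)),
      integral_const_mul]
    rw [balanceMean] at hK
    rw [hK]
    simp
  · have h1 := map_integral_mobiusSphere_squareMap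
      (signIso 1 (-1) 1 (one_mul 1) (by norm_num) (one_mul 1))
      (ballIso_signIso_polar _ _ r) (ballIso_signIso_polar _ _ s) (squareMap_signIso _ _)
    have h2 := congrArg (fun v : E3 => v 1) h1
    simp only [signIso_one] at h2
    simp only [Function.comp, PiLp.zero_apply]
    linarith
  · have h1 := map_integral_mobiusSphere_squareMap
      (signIso 1 1 (-1) (one_mul 1) (one_mul 1) (by norm_num))
      (ballIso_signIso_polar _ _ r) (ballIso_signIso_polar _ _ s) (squareMap_signIso _ _)
    have h2 := congrArg (fun v : E3 => v 2) h1
    simp only [signIso_two] at h2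
    simp only [Function.comp, PiLp.zero_apply]
    linarith

/-! ### Cylindrical coordinates cover the ball -/

theorem coe_cylindrical_zero (r h : ℝ) :
    (cylindrical r 0 h : E3) = !₂[Real.sinh r / (1 + Real.cosh r * Real.cosh h), 0,
      Real.cosh r * Real.sinh h / (1 + Real.cosh r * Real.cosh h)] := by
  rw [cylindrical, coe_mobiusBall, coe_axisPoint, coe_polar_zero, mobius_vertical_horizontal]
  have hr : r = 2 * (r / 2) := by ring
  have hh : h = 2 * (h / 2) := by ring
  have h1 := Real.cosh_sq (r / 2)
  have h2 := Real.cosh_sq (h / 2)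
  have p1 := Real.cosh_pos (r / 2)
  have p2 := Real.cosh_pos (h / 2)
  have e1 : Real.sinh r = 2 * Real.sinh (r / 2) * Real.cosh (r / 2) := by
    conv_lhs => rw [hr]
    exact Real.sinh_two_mul _
  have e2 : Real.sinh h = 2 * Real.sinh (h / 2) * Real.cosh (h / 2) := by
    conv_lhs => rw [hh]
    exact Real.sinh_two_mul _
  have e3 : Real.cosh r = Real.cosh (r / 2) ^ 2 + Real.sinh (r / 2) ^ 2 := by
    conv_lhs => rw [hr]
    exact Real.cosh_two_mul _
  have e4 : Real.cosh h = Real.cosh (h / 2) ^ 2 + Real.sinh (h / 2) ^ 2 := by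
    conv_lhs => rw [hh]
    exact Real.cosh_two_mul _
  rw [e1, e2, e3, e4, Real.tanh_eq_sinh_div_cosh, Real.tanh_eq_sinh_div_cosh]
  generalize Real.sinh (r / 2) = sr at *
  generalize Real.sinh (h / 2) = sh at *
  generalize Real.cosh (r / 2) = cr at *
  generalize Real.cosh (h / 2) = ch at *
  have d1 : 1 + (cr ^ 2 + sr ^ 2) * (ch ^ 2 + sh ^ 2) =
      2 * (cr ^ 2 * ch ^ 2 + sr ^ 2 * sh ^ 2) := by
    rw [h1, h2]; ring
  have d2 : 1 + (sh / ch) ^ 2 * (sr / cr) ^ 2 =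
      (cr ^ 2 * ch ^ 2 + sr ^ 2 * sh ^ 2) / (cr ^ 2 * ch ^ 2) := by
    field_simp
  have d3 : 0 < cr ^ 2 * ch ^ 2 + sr ^ 2 * sh ^ 2 := by positivity
  have d4 : 1 - (sh / ch) ^ 2 = 1 / ch ^ 2 := by
    field_simp; linarith
  rw [d1, d2, d4]
  generalize cr ^ 2 * ch ^ 2 + sr ^ 2 * sh ^ 2 = D at *
  apply ext_E3 <;> simp only [Matrix.cons_val]
  · field_simp
  · field_simp

theorem exists_cylindrical (x : H3) : ∃ r θ h : ℝ, 0 ≤ r ∧ x = cylindrical r θ h := by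
  set z : ℂ := ⟨(x : E3) 0, (x : E3) 1⟩ with hz
  have hn := one_sub_norm_sq_pos x
  have hxn := norm_sq_E3 (x : E3)
  have hzn : ‖z‖ ^ 2 = (x : E3) 0 ^ 2 + (x : E3) 1 ^ 2 := by
    rw [← Complex.normSq_eq_norm_sq, Complex.normSq_apply, hz]; ring
  set n := ‖(x : E3)‖ ^ 2 with hn'
  have hn0 : 0 ≤ n := by positivity
  set r := Real.arsinh (2 * ‖z‖ / (1 - n)) with hr
  set h := Real.arsinh (2 * (x : E3) 2 / ((1 - n) * Real.cosh r)) with hh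
  have hsr : Real.sinh r = 2 * ‖z‖ / (1 - n) := Real.sinh_arsinh _
  have hsh : Real.sinh h = 2 * (x : E3) 2 / ((1 - n) * Real.cosh r) := Real.sinh_arsinh _
  have hcr := Real.cosh_pos r
  have hch := Real.cosh_pos h
  have hprod : Real.cosh r * Real.sinh h = 2 * (x : E3) 2 / (1 - n) := by
    rw [hsh]; field_simp
  have hcc : Real.cosh r * Real.cosh h = (1 + n) / (1 - n) := by
    have : (Real.cosh r * Real.cosh h) ^ 2 = ((1 + n) / (1 - n)) ^ 2 := by
      rw [mul_pow, Real.cosh_sq h, mul_add, ← mul_pow, hprod, mul_one, Real.cosh_sq r, hsr,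
        div_pow, div_pow, div_pow, mul_pow, mul_pow, hzn]
      have : (x : E3) 2 ^ 2 = n - ((x : E3) 0 ^ 2 + (x : E3) 1 ^ 2) := by rw [hxn]; ring
      rw [this]
      field_simp
      ring
    exact (pow_left_inj₀ (by positivity) (by positivity) two_ne_zero).1 this
  have hcc1 : 1 + Real.cosh r * Real.cosh h = 2 / (1 - n) := by
    rw [hcc]; field_simp; ring
  refine ⟨r, Complex.arg z, h, ?_, Subtype.ext ?_⟩
  · rw [hr, Real.arsinh_nonneg_iff]; positivity
  · rw [cylindrical_eq_ballIso, coe_ballIso, coe_cylindrical_zero, hcc1, hsr, hprod]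
    have h0 := Complex.norm_mul_cos_arg z
    have h1 := Complex.norm_mul_sin_arg z
    apply ext_E3
    · rw [axisRotation_zero]
      simp only [Matrix.cons_val]
      rw [← show z.re = (x : E3) 0 from rfl, ← h0]
      field_simp
      ring
    · rw [axisRotation_one]
      simp only [Matrix.cons_val]
      rw [← show z.im = (x : E3) 1 from rfl, ← h1]
      field_simp
      ring
    · rw [axisRotation_two]
      simp only [Matrix.cons_val]
      field_simp

end BaryExt
end

noncomputable section
namespace BaryExt

/-! ### Integration on the sphere in cylindrical coordinates -/

open scoped ENNReal

theorem lintegral_comp_mul_left {a : ℝ} (ha : a ≠ 0) (F : ℝ → ℝ≥0∞) :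
    ∫⁻ y, F y = ENNReal.ofReal |a| * ∫⁻ v, F (a * v) := by
  have h := lintegral_image_eq_lintegral_abs_deriv_mul (s := Set.univ) (f := fun v => a * v)
    (f' := fun _ => a) MeasurableSet.univ
    (fun x _ => (hasDerivAt_const_mul a).hasDerivWithinAt)
    (mul_right_injective₀ ha).injOn F
  rw [Set.image_univ, (mul_left_surjective₀ ha).range_eq] at h
  simp only [Measure.restrict_univ] at h
  rw [h, lintegral_const_mul']
  exact ENNReal.ofReal_ne_top

theorem lintegral_E3 (H : ℝ → ℝ → ℝ → ℝ≥0∞)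
    (hH : Measurable fun p : ℝ × ℝ × ℝ => H p.1 p.2.1 p.2.2) :
    ∫⁻ x : E3, H (x 0) (x 1) (x 2) = ∫⁻ z, ∫⁻ y, ∫⁻ x, H x y z := by
  have e1 := (EuclideanSpace.volume_preserving_symm_measurableEquiv_toLp (Fin 3)).lintegral_comp_emb
    (MeasurableEquiv.measurableEmbedding _) (fun x : Fin 3 → ℝ => H (x 0) (x 1) (x 2))
  have e2 := (volume_preserving_piFinSuccAbove (fun _ : Fin 3 => ℝ) 2).lintegral_comp_emb
    (MeasurableEquiv.measurableEmbedding _)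
    (fun p : ℝ × (Fin 2 → ℝ) => H (p.2 0) (p.2 1) p.1)
  have hm : Measurable (fun p : ℝ × (Fin 2 → ℝ) => H (p.2 0) (p.2 1) p.1) :=
    hH.comp (f := fun p : ℝ × (Fin 2 → ℝ) => (p.2 0, p.2 1, p.1)) (by fun_prop)
  refine e1.trans (e2.trans ?_)
  rw [Measure.volume_eq_prod, lintegral_prod _ hm.aemeasurable]
  refine lintegral_congr fun z => ?_
  have e3 := (volume_preserving_finTwoArrow ℝ).lintegral_comp_emb
    (MeasurableEquiv.measurableEmbedding _) (fun p : ℝ × ℝ => H p.1 p.2 z)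
  refine e3.trans ?_
  have hm2 : Measurable fun p : ℝ × ℝ => H p.1 p.2 z :=
    hH.comp (f := fun p : ℝ × ℝ => (p.1, p.2, z)) (by fun_prop)
  rw [Measure.volume_eq_prod, lintegral_prod_symm _ hm2.aemeasurable]

theorem lintegral_rotate (f : ℝ → ℝ → ℝ → ℝ≥0∞)
    (hf : Measurable fun p : ℝ × ℝ × ℝ => f p.1 p.2.1 p.2.2) :
    ∫⁻ z, ∫⁻ v, ∫⁻ s, f z v s = ∫⁻ v, ∫⁻ s, ∫⁻ z, f z v s := by
  have h1 : Measurable fun q : (ℝ × ℝ) × ℝ => f q.1.1 q.1.2 q.2 :=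
    hf.comp (f := fun q : (ℝ × ℝ) × ℝ => (q.1.1, q.1.2, q.2)) (by fun_prop)
  rw [lintegral_lintegral_swap h1.lintegral_prod_right'.aemeasurable]
  refine lintegral_congr fun v => ?_
  have h2 : Measurable fun q : ℝ × ℝ => f q.1 v q.2 :=
    hf.comp (f := fun q : ℝ × ℝ => (q.1, v, q.2)) (by fun_prop)
  exact lintegral_lintegral_swap h2.aemeasurable

/-- The weight of the coordinates `s = a / √(1 - a²)`, `v = b / c` on the sphere. -/
def sphereWeight (s v : ℝ) : ℝ≥0∞ :=
  ENNReal.ofReal ((√(1 + s ^ 2))⁻¹ ^ 3 * (1 + v ^ 2)⁻¹)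

theorem measurable_sphereWeight : Measurable fun p : ℝ × ℝ => sphereWeight p.1 p.2 := by
  unfold sphereWeight; fun_prop

/-- The indicator of the interval `(-∞, 1)`. -/
def cutoff : ℝ → ℝ≥0∞ := (Set.Iio (1 : ℝ)).indicator 1

theorem measurable_cutoff : Measurable cutoff :=
  measurable_one.indicator measurableSet_Iio

/-- A function of the angular coordinates, in Cartesian coordinates, cut off at radius `1`. -/
def angular (G : ℝ → ℝ → ℝ≥0∞) (x y z : ℝ) : ℝ≥0∞ :=
  G (x / √(x ^ 2 + y ^ 2 + z ^ 2)) (z ^ 2 / √(x ^ 2 + y ^ 2 + z ^ 2) ^ 2) *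
    cutoff √(x ^ 2 + y ^ 2 + z ^ 2)

theorem measurable_angular {G : ℝ → ℝ → ℝ≥0∞} (hG : Measurable fun p : ℝ × ℝ => G p.1 p.2) :
    Measurable fun p : ℝ × ℝ × ℝ => angular G p.1 p.2.1 p.2.2 := by
  refine Measurable.mul ?_ (measurable_cutoff.comp (by fun_prop))
  exact hG.comp (f := fun p : ℝ × ℝ × ℝ => (p.1 / √(p.1 ^ 2 + p.2.1 ^ 2 + p.2.2 ^ 2),
    p.2.2 ^ 2 / √(p.1 ^ 2 + p.2.1 ^ 2 + p.2.2 ^ 2) ^ 2)) (by fun_prop)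

/-- The angular function `G` in the coordinates `s = x / √(y² + z²)` and `v = y / z`. -/
def slopeForm (G : ℝ → ℝ → ℝ≥0∞) (v s : ℝ) : ℝ≥0∞ :=
  G (s / √(1 + s ^ 2)) (1 / ((1 + s ^ 2) * (1 + v ^ 2)))

theorem measurable_slopeForm {G : ℝ → ℝ → ℝ≥0∞} (hG : Measurable fun p : ℝ × ℝ => G p.1 p.2) :
    Measurable fun p : ℝ × ℝ => slopeForm G p.1 p.2 :=
  hG.comp (f := fun p : ℝ × ℝ => (p.2 / √(1 + p.2 ^ 2),
    1 / ((1 + p.2 ^ 2) * (1 + p.1 ^ 2)))) (by fun_prop)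

/-- The radial part of the integrand in slope coordinates. -/
def radialPart (z v s : ℝ) : ℝ≥0∞ :=
  ENNReal.ofReal (z ^ 2 * √(1 + v ^ 2)) * cutoff (|z| * (√(1 + v ^ 2) * √(1 + s ^ 2)))

theorem measurable_radialPart :
    Measurable fun p : ℝ × ℝ × ℝ => radialPart p.1 p.2.1 p.2.2 := by
  refine Measurable.mul (by fun_prop) (measurable_cutoff.comp ?_)
  have : Measurable fun p : ℝ × ℝ × ℝ => |p.1| := measurable_fst.abs
  fun_prop

theorem angular_slope (G : ℝ → ℝ → ℝ≥0∞) {z : ℝ} (hz : z ≠ 0) (v s : ℝ) :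
    ENNReal.ofReal (|z| * abs (|z| * √(1 + v ^ 2))) *
      angular G (|z| * √(1 + v ^ 2) * s) (z * v) z = slopeForm G v s * radialPart z v s := by
  have hz' : 0 < |z| := abs_pos.2 hz
  have hv : 0 < √(1 + v ^ 2) := by positivity
  have hs : 0 < √(1 + s ^ 2) := by positivity
  have e1 : (|z| * √(1 + v ^ 2) * s) ^ 2 + (z * v) ^ 2 + z ^ 2 =
      (|z| * (√(1 + v ^ 2) * √(1 + s ^ 2))) ^ 2 := by
    simp only [mul_pow, sq_abs]
    rw [Real.sq_sqrt (by positivity), Real.sq_sqrt (by positivity)]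
    ring
  have e2 : √((|z| * √(1 + v ^ 2) * s) ^ 2 + (z * v) ^ 2 + z ^ 2) =
      |z| * (√(1 + v ^ 2) * √(1 + s ^ 2)) := by
    rw [e1, Real.sqrt_sq (by positivity)]
  have e3 : |z| * √(1 + v ^ 2) * s / (|z| * (√(1 + v ^ 2) * √(1 + s ^ 2))) =
      s / √(1 + s ^ 2) := by
    field_simp
  have e4 : z ^ 2 / (|z| * (√(1 + v ^ 2) * √(1 + s ^ 2))) ^ 2 =
      1 / ((1 + s ^ 2) * (1 + v ^ 2)) := by
    simp only [mul_pow, sq_abs]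
    rw [Real.sq_sqrt (by positivity), Real.sq_sqrt (by positivity)]
    field_simp
  have e5 : |z| * abs (|z| * √(1 + v ^ 2)) = z ^ 2 * √(1 + v ^ 2) := by
    rw [abs_of_pos (show 0 < |z| * √(1 + v ^ 2) by positivity), ← mul_assoc, ← sq, sq_abs]
  rw [angular, slopeForm, radialPart, e2, e3, e4, e5, mul_left_comm]

theorem lintegral_slice (G : ℝ → ℝ → ℝ≥0∞) {z : ℝ} (hz : z ≠ 0) :
    ∫⁻ y, ∫⁻ x, angular G x y z = ∫⁻ v, ∫⁻ s, slopeForm G v s * radialPart z v s := by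
  rw [lintegral_comp_mul_left hz, ← lintegral_const_mul' _ _ ENNReal.ofReal_ne_top]
  refine lintegral_congr fun v => ?_
  have hz' : 0 < |z| := abs_pos.2 hz
  have hv : 0 < √(1 + v ^ 2) := by positivity
  rw [lintegral_comp_mul_left (a := |z| * √(1 + v ^ 2)) (by positivity),
    ← mul_assoc, ← ENNReal.ofReal_mul (abs_nonneg z),
    ← lintegral_const_mul' _ _ ENNReal.ofReal_ne_top]
  exact lintegral_congr fun s => angular_slope G hz v s

/-- The constant `∫ z² 1_{|z| < 1} dz`. -/
def secondMoment : ℝ≥0∞ := ∫⁻ z : ℝ, ENNReal.ofReal (z ^ 2) * cutoff |z|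

theorem lintegral_radialPart (v s : ℝ) :
    ∫⁻ z, radialPart z v s = secondMoment * sphereWeight s v := by
  have hp : 0 < √(1 + v ^ 2) * √(1 + s ^ 2) := by positivity
  have hi : 0 < (√(1 + v ^ 2) * √(1 + s ^ 2))⁻¹ := inv_pos.2 hp
  rw [lintegral_comp_mul_left hi.ne',
    secondMoment, mul_comm, ← lintegral_mul_const' _ _ ENNReal.ofReal_ne_top, sphereWeight,
    ← lintegral_mul_const' _ _ ENNReal.ofReal_ne_top]
  refine lintegral_congr fun z => ?_
  rw [radialPart, abs_mul, abs_of_pos hi, mul_right_comm _ |z|, inv_mul_cancel₀ hp.ne', one_mul,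
    mul_right_comm, ← ENNReal.ofReal_mul (by positivity), mul_right_comm (ENNReal.ofReal _),
    ← ENNReal.ofReal_mul (by positivity)]
  congr 2
  have hs2 : (1 + v ^ 2)⁻¹ = (√(1 + v ^ 2))⁻¹ ^ 2 := by
    rw [inv_pow, Real.sq_sqrt (by positivity)]
  rw [hs2]
  have hv : 0 < √(1 + v ^ 2) := by positivity
  have hs : 0 < √(1 + s ^ 2) := by positivity
  generalize √(1 + v ^ 2) = V at *
  generalize √(1 + s ^ 2) = U at *
  field_simp

theorem lintegral_unitBall_angular (G : ℝ → ℝ → ℝ≥0∞)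
    (hG : Measurable fun p : ℝ × ℝ => G p.1 p.2) :
    ∫⁻ x : E3, G (x 0 / ‖x‖) (x 2 ^ 2 / ‖x‖ ^ 2) * cutoff ‖x‖ =
      secondMoment * ∫⁻ v, ∫⁻ s, slopeForm G v s * sphereWeight s v := by
  have h1 : ∫⁻ x : E3, G (x 0 / ‖x‖) (x 2 ^ 2 / ‖x‖ ^ 2) * cutoff ‖x‖ =
      ∫⁻ x : E3, angular G (x 0) (x 1) (x 2) := by
    refine lintegral_congr fun x => ?_
    rw [angular, ← norm_sq_E3, Real.sqrt_sq (norm_nonneg x)]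
  have hS := measurable_slopeForm hG
  have hS' : Measurable fun p : ℝ × ℝ × ℝ => slopeForm G p.2.1 p.2.2 :=
    hS.comp (f := fun p : ℝ × ℝ × ℝ => p.2) measurable_snd
  have hm : Measurable fun p : ℝ × ℝ × ℝ =>
      slopeForm G p.2.1 p.2.2 * radialPart p.1 p.2.1 p.2.2 := by
    exact hS'.mul measurable_radialPart
  have hW : Measurable fun q : ℝ × ℝ => sphereWeight q.2 q.1 :=
    measurable_sphereWeight.comp (f := fun q : ℝ × ℝ => (q.2, q.1)) (by fun_prop)
  have hR : Measurable fun q : ℝ × ℝ => slopeForm G q.1 q.2 * sphereWeight q.2 q.1 :=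
    by exact hS.mul hW
  have h3 : ∫⁻ z, ∫⁻ y, ∫⁻ x, angular G x y z =
      ∫⁻ z, ∫⁻ v, ∫⁻ s, slopeForm G v s * radialPart z v s := by
    refine lintegral_congr_ae ?_
    filter_upwards [compl_mem_ae_iff.2 (measure_singleton (0 : ℝ))] with z hz
    exact lintegral_slice G hz
  rw [h1, lintegral_E3 (angular G) (measurable_angular hG), h3,
    lintegral_rotate (fun z v s => slopeForm G v s * radialPart z v s) hm,
    ← lintegral_const_mul _ hR.lintegral_prod_right']
  refine lintegral_congr fun v => ?_
  have hR2 : Measurable fun s : ℝ => slopeForm G v s * sphereWeight s v :=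
    hR.comp (f := fun s => (v, s)) (by fun_prop)
  rw [← lintegral_const_mul _ hR2]
  refine lintegral_congr fun s => ?_
  have hm2 : Measurable fun z : ℝ => radialPart z v s :=
    measurable_radialPart.comp (f := fun z => (z, v, s)) (by fun_prop)
  rw [lintegral_const_mul _ hm2, lintegral_radialPart, mul_left_comm]

theorem lintegral_toSphere (G : ℝ → ℝ → ℝ≥0∞) (hG : Measurable fun p : ℝ × ℝ => G p.1 p.2) :
    ∫⁻ x : E3, G (x 0 / ‖x‖) (x 2 ^ 2 / ‖x‖ ^ 2) * cutoff ‖x‖ =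
      (∫⁻ ζ : S2, G (ζ.1 0) (ζ.1 2 ^ 2) ∂(volume : Measure E3).toSphere) *
        ENNReal.ofReal (1 / 3) := by
  have h0 := (continuous_apply_S2 0).measurable
  have h2 := (continuous_apply_S2 2).measurable
  have hmp := (volume : Measure E3).measurePreserving_homeomorphUnitSphereProd
  have e1 := hmp.lintegral_comp_emb (Homeomorph.measurableEmbedding _)
    (fun p : S2 × Set.Ioi (0 : ℝ) => G (p.1.1 0) (p.1.1 2 ^ 2) *
      cutoff p.2.1)
  rw [lintegral_prod_mul (f := fun ζ : S2 => G (ζ.1 0) (ζ.1 2 ^ 2))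
    (g := fun r : Set.Ioi (0 : ℝ) => cutoff r.1)
    (hG.comp (f := fun ζ : S2 => (ζ.1 0, ζ.1 2 ^ 2)) (by fun_prop)).aemeasurable
    (measurable_cutoff.comp measurable_subtype_coe).aemeasurable] at e1
  have e2 : ∫⁻ r : Set.Ioi (0 : ℝ), cutoff r.1
      ∂Measure.volumeIoiPow (Module.finrank ℝ E3 - 1) = ENNReal.ofReal (1 / 3) := by
    have e3 (r : Set.Ioi (0 : ℝ)) : cutoff r.1 =
        (Set.Iio (⟨1, Set.mem_Ioi.2 one_pos⟩ : Set.Ioi (0 : ℝ))).indicator 1 r := by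
      simp [cutoff, Set.indicator, ← Subtype.coe_lt_coe]
    simp_rw [e3]
    rw [lintegral_indicator_one measurableSet_Iio, Measure.volumeIoiPow_apply_Iio]
    norm_num
  rw [e2] at e1
  rw [← e1]
  have e4 (x : ({0}ᶜ : Set E3)) : G (((homeomorphUnitSphereProd E3 x).1 : E3) 0)
      (((homeomorphUnitSphereProd E3 x).1 : E3) 2 ^ 2) *
      cutoff (homeomorphUnitSphereProd E3 x).2.1 =
      (fun x : E3 => G (x 0 / ‖x‖) (x 2 ^ 2 / ‖x‖ ^ 2) *
        cutoff ‖x‖) x := by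
    simp only [homeomorphUnitSphereProd_apply_fst_coe, homeomorphUnitSphereProd_apply_snd_coe,
      PiLp.smul_apply, smul_eq_mul, mul_pow, inv_pow]
    rw [div_eq_inv_mul, div_eq_inv_mul]
  simp_rw [e4]
  rw [lintegral_subtype_comap (measurableSet_singleton _).compl (fun x : E3 =>
    G (x 0 / ‖x‖) (x 2 ^ 2 / ‖x‖ ^ 2) * cutoff ‖x‖),
    restrict_compl_singleton]

/-- Integrals over the sphere of functions of `a` and `c²`, up to a normalization. -/
theorem lintegral_sphereMeasure_mul (G : ℝ → ℝ → ℝ≥0∞)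
    (hG : Measurable fun p : ℝ × ℝ => G p.1 p.2) :
    (∫⁻ ζ : S2, G (ζ.1 0) (ζ.1 2 ^ 2) ∂sphereMeasure) * (∫⁻ v, ∫⁻ s, sphereWeight s v) =
      ∫⁻ v, ∫⁻ s, slopeForm G v s * sphereWeight s v := by
  set μ := (volume : Measure E3).toSphere with hμ
  have h1 := (lintegral_toSphere G hG).symm.trans (lintegral_unitBall_angular G hG)
  have h2 := (lintegral_toSphere (fun _ _ => 1) measurable_const).symm.trans
    (lintegral_unitBall_angular (fun _ _ => 1) measurable_const)
  simp only [slopeForm, lintegral_const, one_mul] at h2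
  rw [← hμ] at h1 h2
  have hμ0 : μ Set.univ ≠ 0 := by
    rw [ne_eq, Measure.measure_univ_eq_zero]
    exact Measure.toSphere_ne_zero _
  have hμt : μ Set.univ ≠ ∞ := measure_ne_top _ _
  have h30 : ENNReal.ofReal (1 / 3) ≠ 0 := by simp
  have h3t : ENNReal.ofReal (1 / 3) ≠ ∞ := ENNReal.ofReal_ne_top
  have hc0 : secondMoment ≠ 0 := by
    intro h; rw [h, zero_mul] at h2; exact mul_ne_zero hμ0 h30 h2
  have hI0 : ∫⁻ v, ∫⁻ s, sphereWeight s v ≠ 0 := by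
    intro h; rw [h, mul_zero] at h2; exact mul_ne_zero hμ0 h30 h2
  have hct : secondMoment ≠ ∞ := by
    intro h; rw [h, ENNReal.top_mul hI0] at h2; exact ENNReal.mul_ne_top hμt h3t h2
  rw [sphereMeasure, lintegral_smul_measure, smul_eq_mul, ← hμ]
  set J := ∫⁻ ζ : S2, G (ζ.1 0) (ζ.1 2 ^ 2) ∂μ
  set I := ∫⁻ v, ∫⁻ s, sphereWeight s v
  set R := ∫⁻ v, ∫⁻ s, slopeForm G v s * sphereWeight s v
  refine (ENNReal.mul_right_inj hc0 hct).1 ?_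
  rw [← h1]
  calc secondMoment * ((μ Set.univ)⁻¹ * J * I) = (μ Set.univ)⁻¹ * J * (secondMoment * I) := by ring
    _ = ((μ Set.univ)⁻¹ * μ Set.univ) * (J * ENNReal.ofReal (1 / 3)) := by rw [← h2]; ring
    _ = _ := by rw [ENNReal.inv_mul_cancel hμ0 hμt, one_mul]

end BaryExt
end

noncomputable section
namespace BaryExt

open scoped ENNReal

theorem lintegral_inv_add_mul_sq {p q : ℝ} (hp : 0 < p) (hq : 0 < q) :
    ∫⁻ v, ENNReal.ofReal (p + q * v ^ 2)⁻¹ = ENNReal.ofReal (Real.pi / √(p * q)) := by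
  have h0 : ∫⁻ v : ℝ, ENNReal.ofReal (1 + v ^ 2)⁻¹ = ENNReal.ofReal Real.pi := by
    rw [← ofReal_integral_eq_lintegral_ofReal integrable_inv_one_add_sq
      (ae_of_all _ fun v => by positivity), integral_univ_inv_one_add_sq]
  have hr : 0 < √(p / q) := by positivity
  have hr2 : √(p / q) ^ 2 = p / q := Real.sq_sqrt (by positivity)
  have hs : √(p * q) = √(p / q) * q := by
    rw [← Real.sqrt_sq hq.le, ← Real.sqrt_mul (by positivity), Real.sqrt_sq hq.le]
    congr 1
    field_simp
  have h1 (v : ℝ) : (p + q * (√(p / q) * v) ^ 2)⁻¹ = p⁻¹ * (1 + v ^ 2)⁻¹ := by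
    rw [mul_pow, hr2, ← mul_inv]
    congr 1
    field_simp
  rw [lintegral_comp_mul_left hr.ne']
  simp_rw [h1]
  simp_rw [ENNReal.ofReal_mul (inv_pos.2 hp).le]
  rw [lintegral_const_mul' _ _ ENNReal.ofReal_ne_top, h0, ← ENNReal.ofReal_mul (by positivity),
    ← ENNReal.ofReal_mul (by positivity), abs_of_pos hr, hs]
  congr 1
  have : p = √(p / q) ^ 2 * q := by rw [hr2]; field_simp
  generalize √(p / q) = R at *
  rw [this]
  field_simp

theorem hasDerivAt_div_sqrt (s : ℝ) :
    HasDerivAt (fun s => s / √(1 + s ^ 2)) ((√(1 + s ^ 2))⁻¹ ^ 3) s := by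
  have hs : 0 < √(1 + s ^ 2) := by positivity
  have h1 : HasDerivAt (fun s : ℝ => 1 + s ^ 2) (2 * s) s := by
    simpa using (hasDerivAt_pow 2 s).const_add 1
  have h2 := (hasDerivAt_id s).div (h1.sqrt (by positivity)) hs.ne'
  convert! h2 using 1
  have h3 : √(1 + s ^ 2) ^ 2 = 1 + s ^ 2 := Real.sq_sqrt (by positivity)
  generalize √(1 + s ^ 2) = U at *
  simp only [id]
  field_simp
  linarith

theorem one_sub_div_sqrt_sq (s : ℝ) : 1 - (s / √(1 + s ^ 2)) ^ 2 = 1 / (1 + s ^ 2) := by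
  rw [div_pow, Real.sq_sqrt (by positivity)]
  field_simp
  ring

theorem range_div_sqrt : Set.range (fun s : ℝ => s / √(1 + s ^ 2)) = Set.Ioo (-1) 1 := by
  ext a
  constructor
  · rintro ⟨s, rfl⟩
    have h := one_sub_div_sqrt_sq s
    have : 0 < 1 / (1 + s ^ 2) := by positivity
    exact abs_lt.1 ((sq_lt_one_iff_abs_lt_one _).1 (by linarith))
  · rintro ⟨h1, h2⟩
    have h3 : 0 < 1 - a ^ 2 := by nlinarith
    refine ⟨a / √(1 - a ^ 2), ?_⟩
    have h4 : 1 + (a / √(1 - a ^ 2)) ^ 2 = (1 / √(1 - a ^ 2)) ^ 2 := by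
      rw [div_pow, div_pow, Real.sq_sqrt h3.le]
      field_simp
      ring
    have h5 : 0 < √(1 - a ^ 2) := by positivity
    simp only
    rw [h4, Real.sqrt_sq (by positivity)]
    field_simp

theorem injective_div_sqrt : Function.Injective fun s : ℝ => s / √(1 + s ^ 2) := by
  refine (strictMono_of_deriv_pos fun s => ?_).injective
  rw [(hasDerivAt_div_sqrt s).deriv]
  positivity

theorem lintegral_div_sqrt (F : ℝ → ℝ≥0∞) :
    ∫⁻ s, ENNReal.ofReal ((√(1 + s ^ 2))⁻¹ ^ 3) * F (s / √(1 + s ^ 2)) =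
      ∫⁻ a in Set.Ioo (-1) 1, F a := by
  have h := lintegral_image_eq_lintegral_abs_deriv_mul MeasurableSet.univ
    (fun s _ => (hasDerivAt_div_sqrt s).hasDerivWithinAt) injective_div_sqrt.injOn F
  rw [Set.image_univ, range_div_sqrt, Measure.restrict_univ] at h
  rw [h]
  refine lintegral_congr fun s => ?_
  rw [abs_of_pos (by positivity)]

/-- The two factors under the root in the one-dimensional form of `balanceMean`. -/
def quadForm (T κ a : ℝ) : ℝ := (a + T) ^ 2 + κ * (1 - a ^ 2)

theorem quadForm_pos {T κ a : ℝ} (hT : |T| < 1) (hκ : 0 < κ) (ha : a ∈ Set.Icc (-1) 1) :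
    0 < quadForm T κ a := by
  have hT' := abs_lt.1 hT
  have ha2 : a ^ 2 ≤ 1 := by nlinarith [ha.1, ha.2]
  rw [quadForm]
  rcases ha2.lt_or_eq with h | h
  · have : 0 < κ * (1 - a ^ 2) := mul_pos hκ (by linarith)
    positivity
  · have h1 : 0 < (a + T) ^ 2 := by
      refine sq_pos_of_ne_zero fun h0 => ?_
      have : a = -T := by linarith
      rw [this] at h
      nlinarith
    rw [h]; linarith

theorem lintegral_sphereWeight :
    ∫⁻ v, ∫⁻ s, sphereWeight s v = ENNReal.ofReal (2 * Real.pi) := by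
  have h1 (v : ℝ) : ∫⁻ s, sphereWeight s v = ENNReal.ofReal (1 + v ^ 2)⁻¹ * 2 := by
    have h2 (s : ℝ) : sphereWeight s v = ENNReal.ofReal (1 + v ^ 2)⁻¹ *
        (ENNReal.ofReal ((√(1 + s ^ 2))⁻¹ ^ 3) * 1) := by
      rw [sphereWeight, mul_comm, ENNReal.ofReal_mul (by positivity), mul_one]
    simp_rw [h2]
    rw [lintegral_const_mul' _ _ ENNReal.ofReal_ne_top, lintegral_div_sqrt (fun _ => 1)]
    norm_num
  simp_rw [h1]
  rw [lintegral_mul_const' _ _ (by simp)]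
  have := lintegral_inv_add_mul_sq one_pos one_pos
  simp only [one_mul, mul_one, Real.sqrt_one, div_one] at this
  rw [this, mul_comm 2, ENNReal.ofReal_mul Real.pi_pos.le]
  simp

theorem lintegral_slopeForm_kernel {T κ : ℝ} (hT : |T| < 1) (hκ : 0 < κ) (s : ℝ) :
    ∫⁻ v, slopeForm (fun a t => ENNReal.ofReal (κ * (1 - a ^ 2) /
      ((a + T) ^ 2 + (1 - T ^ 2) * t + κ * (1 - a ^ 2)))) v s * sphereWeight s v =
    ENNReal.ofReal ((√(1 + s ^ 2))⁻¹ ^ 3) * (fun a => ENNReal.ofReal (κ * (1 - a ^ 2) *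
      (Real.pi / √(quadForm T (κ + (1 - T ^ 2)) a * quadForm T κ a)))) (s / √(1 + s ^ 2)) := by
  have hw := one_sub_div_sqrt_sq s
  have hmem : s / √(1 + s ^ 2) ∈ Set.Icc (-1 : ℝ) 1 := by
    have : s / √(1 + s ^ 2) ∈ Set.range (fun s : ℝ => s / √(1 + s ^ 2)) := ⟨s, rfl⟩
    rw [range_div_sqrt] at this
    exact Set.Ioo_subset_Icc_self this
  have hU : 0 < √(1 + s ^ 2) := by positivity
  simp only [slopeForm]
  have hm : 0 < 1 - T ^ 2 := by have := abs_lt.1 hT; nlinarith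
  have hN1 := quadForm_pos hT hκ hmem
  have hN2 := quadForm_pos hT (add_pos hκ hm) hmem
  have hwpos : 0 < 1 - (s / √(1 + s ^ 2)) ^ 2 := by rw [hw]; positivity
  have hc (v : ℝ) : 1 / ((1 + s ^ 2) * (1 + v ^ 2)) =
      (1 - (s / √(1 + s ^ 2)) ^ 2) / (1 + v ^ 2) := by
    rw [hw]; field_simp
  simp_rw [hc]
  generalize s / √(1 + s ^ 2) = a at *
  simp_rw [sphereWeight]
  generalize √(1 + s ^ 2) = U at *
  have key (v : ℝ) : ENNReal.ofReal (κ * (1 - a ^ 2) /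
      ((a + T) ^ 2 + (1 - T ^ 2) * ((1 - a ^ 2) / (1 + v ^ 2)) + κ * (1 - a ^ 2))) *
      ENNReal.ofReal (U⁻¹ ^ 3 * (1 + v ^ 2)⁻¹) =
      ENNReal.ofReal (U⁻¹ ^ 3 * (κ * (1 - a ^ 2))) * ENNReal.ofReal
      (quadForm T (κ + (1 - T ^ 2)) a + quadForm T κ a * v ^ 2)⁻¹ := by
    have hv : 0 < 1 + v ^ 2 := by positivity
    have e : (a + T) ^ 2 + (1 - T ^ 2) * ((1 - a ^ 2) / (1 + v ^ 2)) + κ * (1 - a ^ 2) =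
        (quadForm T (κ + (1 - T ^ 2)) a + quadForm T κ a * v ^ 2) / (1 + v ^ 2) := by
      rw [quadForm, quadForm]; field_simp; ring
    have hQ : 0 < quadForm T (κ + (1 - T ^ 2)) a + quadForm T κ a * v ^ 2 := by positivity
    rw [e, ← ENNReal.ofReal_mul (by positivity), ← ENNReal.ofReal_mul (by positivity)]
    congr 1
    generalize quadForm T (κ + (1 - T ^ 2)) a + quadForm T κ a * v ^ 2 = Q at *
    generalize 1 - a ^ 2 = w at *
    field_simp
  simp_rw [key]
  rw [lintegral_const_mul' _ _ ENNReal.ofReal_ne_top, lintegral_inv_add_mul_sq hN2 hN1,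
    ← ENNReal.ofReal_mul (by positivity), ← ENNReal.ofReal_mul (by positivity), mul_assoc]

theorem continuousOn_quadForm (T κ : ℝ) : Continuous (quadForm T κ) := by
  unfold quadForm; fun_prop

theorem intervalIntegrable_of_continuousOn_Icc {f : ℝ → ℝ} (hf : ContinuousOn f (Set.Icc (-1) 1)) :
    IntervalIntegrable f volume (-1) 1 :=
  (hf.mono (by rw [Set.uIcc_of_le (by norm_num)])).intervalIntegrable

/-- The one-dimensional form of `balanceMean`. -/
theorem balanceMean_eq_intervalIntegral {T κ : ℝ} (hT : |T| < 1) (hκ : 0 < κ) :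
    balanceMean T κ = (1 / 2) * ∫ a in (-1 : ℝ)..1, κ * (1 - a ^ 2) /
      √(quadForm T (κ + (1 - T ^ 2)) a * quadForm T κ a) := by
  have hm : 0 < 1 - T ^ 2 := by have := abs_lt.1 hT; nlinarith
  set G : ℝ → ℝ → ℝ≥0∞ := fun a t => ENNReal.ofReal (κ * (1 - a ^ 2) /
      ((a + T) ^ 2 + (1 - T ^ 2) * t + κ * (1 - a ^ 2))) with hGdef
  have hG : Measurable fun p : ℝ × ℝ => G p.1 p.2 := by
    simp only [hGdef]; fun_prop
  have h1 := lintegral_sphereMeasure_mul G hG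
  have hS := measurable_slopeForm hG
  have hW : Measurable fun q : ℝ × ℝ => sphereWeight q.2 q.1 :=
    measurable_sphereWeight.comp (f := fun q : ℝ × ℝ => (q.2, q.1)) (by fun_prop)
  have hR : Measurable fun q : ℝ × ℝ => slopeForm G q.1 q.2 * sphereWeight q.2 q.1 := by
    exact hS.mul hW
  rw [lintegral_sphereWeight, lintegral_lintegral_swap hR.aemeasurable] at h1
  rw [lintegral_congr (lintegral_slopeForm_kernel hT hκ),
    lintegral_div_sqrt (fun a => ENNReal.ofReal (κ * (1 - a ^ 2) *
      (Real.pi / √(quadForm T (κ + (1 - T ^ 2)) a * quadForm T κ a))))] at h1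
  have hnn (ζ : S2) : 0 ≤ balanceKernel T κ ζ := by
    have := balanceDenom_pos hT hκ ζ
    have h0 := apply_sq_le_one ζ 0
    have h2 : 0 ≤ 1 - ζ.1 0 ^ 2 := by linarith
    rw [balanceKernel]; positivity
  have h2 : ∫⁻ ζ : S2, G (ζ.1 0) (ζ.1 2 ^ 2) ∂sphereMeasure =
      ENNReal.ofReal (balanceMean T κ) := by
    rw [balanceMean, ofReal_integral_eq_lintegral_ofReal
      (integrable_of_continuous_S2 (continuous_balanceKernel hT hκ)) (ae_of_all _ hnn)]
    rfl
  have hcont : ContinuousOn (fun a : ℝ => κ * (1 - a ^ 2) *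
      (Real.pi / √(quadForm T (κ + (1 - T ^ 2)) a * quadForm T κ a))) (Set.Icc (-1) 1) := by
    have c1 := (continuousOn_quadForm T κ).continuousOn (s := Set.Icc (-1) 1)
    have c2 := (continuousOn_quadForm T (κ + (1 - T ^ 2))).continuousOn (s := Set.Icc (-1) 1)
    refine ContinuousOn.mul (by fun_prop) (ContinuousOn.div continuousOn_const
      (c2.mul c1).sqrt fun a ha => ?_)
    have := quadForm_pos hT hκ ha
    have := quadForm_pos hT (add_pos hκ hm) ha
    positivity
  have hnn2 : ∀ a ∈ Set.Ioo (-1 : ℝ) 1, 0 ≤ κ * (1 - a ^ 2) *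
      (Real.pi / √(quadForm T (κ + (1 - T ^ 2)) a * quadForm T κ a)) := by
    intro a ha
    have : 0 ≤ 1 - a ^ 2 := by nlinarith [ha.1, ha.2]
    have := Real.pi_pos
    positivity
  have hint := (intervalIntegrable_of_continuousOn_Icc hcont).1
  have h3 : 0 ≤ balanceMean T κ := integral_nonneg hnn
  rw [h2, ← ofReal_integral_eq_lintegral_ofReal (hint.mono_set Set.Ioo_subset_Ioc_self)
    ((ae_restrict_mem measurableSet_Ioo).mono hnn2),
    ← ENNReal.ofReal_mul h3] at h1
  have hpi := Real.pi_pos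
  rw [ENNReal.ofReal_eq_ofReal_iff (by positivity)
    (setIntegral_nonneg measurableSet_Ioo hnn2), ← integral_Ioc_eq_integral_Ioo,
    ← intervalIntegral.integral_of_le (by norm_num)] at h1
  have h4 : ∫ a in (-1 : ℝ)..1, κ * (1 - a ^ 2) *
      (Real.pi / √(quadForm T (κ + (1 - T ^ 2)) a * quadForm T κ a)) =
      Real.pi * ∫ a in (-1 : ℝ)..1, κ * (1 - a ^ 2) /
      √(quadForm T (κ + (1 - T ^ 2)) a * quadForm T κ a) := by
    rw [← intervalIntegral.integral_const_mul]
    refine intervalIntegral.integral_congr fun a _ => ?_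
    ring
  rw [h4] at h1
  have h5 : Real.pi * (2 * balanceMean T κ) = Real.pi * ∫ a in (-1 : ℝ)..1, κ * (1 - a ^ 2) /
      √(quadForm T (κ + (1 - T ^ 2)) a * quadForm T κ a) := by rw [← h1]; ring
  have := mul_left_cancel₀ hpi.ne' h5
  linarith

end BaryExt
end

noncomputable section
namespace BaryExt

/-! ### The bounds for the mean at `κ = 1` and `κ = 1 - T²` -/

/-- The derivative of `b ↦ (1 - T²) b / (1 - T² b²)`. -/
def evenWeight (T b : ℝ) : ℝ := (1 - T ^ 2) * (1 + T ^ 2 * b ^ 2) / (1 - T ^ 2 * b ^ 2) ^ 2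

theorem one_sub_mul_pos {T b : ℝ} (hT : |T| < 1) (hb : b ∈ Set.Icc (-1) 1) : 0 < 1 - b * T := by
  have h1 : |b| ≤ 1 := abs_le.2 hb
  have h2 : |b * T| < 1 := by rw [abs_mul]; nlinarith [abs_nonneg b, abs_nonneg T]
  linarith [le_abs_self (b * T)]

theorem one_sub_sq_mul_sq_pos {T b : ℝ} (hT : |T| < 1) (hb : b ∈ Set.Icc (-1) 1) :
    0 < 1 - T ^ 2 * b ^ 2 := by
  have h1 := one_sub_mul_pos hT hb
  have h2 := one_sub_mul_pos (T := -T) (by rwa [abs_neg]) hb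
  nlinarith

theorem one_sub_sq_pos {T : ℝ} (hT : |T| < 1) : 0 < 1 - T ^ 2 := by
  have := abs_lt.1 hT; nlinarith

/-- `quadForm` after the substitution `a = (b - T) / (1 - b T)`. -/
def evenQuad (T κ b : ℝ) : ℝ := (1 - T ^ 2) * b ^ 2 + κ * (1 - b ^ 2)

theorem evenQuad_pos {T κ b : ℝ} (hT : |T| < 1) (hκ : 0 < κ) (hb : b ∈ Set.Icc (-1) 1) :
    0 < evenQuad T κ b := by
  have hm := one_sub_sq_pos hT
  have hb2 : 0 ≤ 1 - b ^ 2 := by nlinarith [hb.1, hb.2]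
  rw [evenQuad]
  rcases eq_or_ne b 0 with rfl | h
  · simpa using hκ
  · positivity

theorem quadForm_substitution {T κ b : ℝ} (h : 1 - b * T ≠ 0) :
    quadForm T κ ((b - T) / (1 - b * T)) =
      (1 - T ^ 2) * evenQuad T κ b / (1 - b * T) ^ 2 := by
  rw [quadForm, evenQuad]
  generalize hD : 1 - b * T = D at *
  field_simp
  rw [← hD]
  ring

theorem hasDerivAt_substitution {T b : ℝ} (h : 1 - b * T ≠ 0) :
    HasDerivAt (fun b => (b - T) / (1 - b * T)) ((1 - T ^ 2) / (1 - b * T) ^ 2) b := by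
  have h1 : HasDerivAt (fun b : ℝ => 1 - b * T) (-T) b := by
    simpa using ((hasDerivAt_id b).mul_const T).const_sub 1
  have h2 := ((hasDerivAt_id b).sub_const T).div h1 h
  convert! h2 using 1
  simp only [id]
  congr 1
  ring

theorem balanceMean_eq_even {T κ : ℝ} (hT : |T| < 1) (hκ : 0 < κ) :
    balanceMean T κ = (1 / 2) * ∫ b in (-1 : ℝ)..1, evenWeight T b *
      (κ * (1 - b ^ 2) / √(evenQuad T (κ + (1 - T ^ 2)) b * evenQuad T κ b)) := by
  have hm := one_sub_sq_pos hT
  have hT' := abs_lt.1 hT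
  rw [balanceMean_eq_intervalIntegral hT hκ]
  congr 1
  set H : ℝ → ℝ := fun b => κ * (1 - b ^ 2) / √(evenQuad T (κ + (1 - T ^ 2)) b * evenQuad T κ b)
    with hH
  have hu : Set.uIcc (-1 : ℝ) 1 = Set.Icc (-1) 1 := Set.uIcc_of_le (by norm_num)
  have hne : ∀ b ∈ Set.Icc (-1 : ℝ) 1, 1 - b * T ≠ 0 := fun b hb => (one_sub_mul_pos hT hb).ne'
  have hHc : ContinuousOn H (Set.Icc (-1) 1) := by
    refine ContinuousOn.div (by fun_prop) (Continuous.continuousOn (by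
      unfold evenQuad; fun_prop)) fun b hb => ?_
    have := evenQuad_pos hT hκ hb
    have := evenQuad_pos hT (add_pos hκ hm) hb
    positivity
  have hgc : ContinuousOn (fun b : ℝ => (1 - T ^ 2) / (1 - b * T) ^ 2) (Set.Icc (-1) 1) :=
    ContinuousOn.div continuousOn_const (by fun_prop) fun b hb => pow_ne_zero 2 (hne b hb)
  have hgc' : ContinuousOn (fun b : ℝ => (1 - T ^ 2) / (1 - b * -T) ^ 2) (Set.Icc (-1) 1) :=
    ContinuousOn.div continuousOn_const (by fun_prop) fun b hb => pow_ne_zero 2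
      (one_sub_mul_pos (T := -T) (by rwa [abs_neg]) hb).ne'
  have hsub := intervalIntegral.integral_comp_mul_deriv_of_deriv_nonneg (a := -1) (b := 1)
    (f := fun b => (b - T) / (1 - b * T)) (f' := fun b => (1 - T ^ 2) / (1 - b * T) ^ 2)
    (g := fun a => κ * (1 - a ^ 2) / √(quadForm T (κ + (1 - T ^ 2)) a * quadForm T κ a))
    (by rw [hu]; exact ContinuousOn.div (by fun_prop) (by fun_prop) hne)
    (fun b hb => hasDerivAt_substitution (hne b (by
      rw [min_eq_left (by norm_num), max_eq_right (by norm_num)] at hb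
      exact Set.Ioo_subset_Icc_self hb)))
    (fun b _ => by positivity)
  have e1 : ((-1 : ℝ) - T) / (1 - -1 * T) = -1 := by
    rw [div_eq_iff (by linarith)]; ring
  have e2 : ((1 : ℝ) - T) / (1 - 1 * T) = 1 := by
    rw [one_mul, div_self (by linarith)]
  simp only [e1, e2] at hsub
  have h1 : ∀ b ∈ Set.uIcc (-1 : ℝ) 1,
      ((fun a => κ * (1 - a ^ 2) / √(quadForm T (κ + (1 - T ^ 2)) a * quadForm T κ a)) ∘
        fun b => (b - T) / (1 - b * T)) b * ((1 - T ^ 2) / (1 - b * T) ^ 2) =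
      (1 - T ^ 2) / (1 - b * T) ^ 2 * H b := by
    intro b hb
    rw [hu] at hb
    have hD := one_sub_mul_pos hT hb
    have hq := mul_pos (evenQuad_pos hT (add_pos hκ hm) hb) (evenQuad_pos hT hκ hb)
    simp only [Function.comp, hH]
    rw [quadForm_substitution hD.ne', quadForm_substitution hD.ne']
    have h2 : 1 - ((b - T) / (1 - b * T)) ^ 2 = (1 - T ^ 2) * (1 - b ^ 2) / (1 - b * T) ^ 2 := by
      generalize hE : 1 - b * T = D at *
      field_simp
      rw [← hE]
      ring
    have h3 : (1 - T ^ 2) * evenQuad T (κ + (1 - T ^ 2)) b / (1 - b * T) ^ 2 *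
        ((1 - T ^ 2) * evenQuad T κ b / (1 - b * T) ^ 2) =
        ((1 - T ^ 2) / (1 - b * T) ^ 2) ^ 2 *
          (evenQuad T (κ + (1 - T ^ 2)) b * evenQuad T κ b) := by ring
    rw [h2, h3, Real.sqrt_mul (by positivity), Real.sqrt_sq (by positivity)]
    have hs := Real.sqrt_pos.2 hq
    field_simp
  rw [intervalIntegral.integral_congr h1] at hsub
  rw [← hsub]
  have hneg : ∫ b in (-1 : ℝ)..1, (1 - T ^ 2) / (1 - b * T) ^ 2 * H b =
      ∫ b in (-1 : ℝ)..1, (1 - T ^ 2) / (1 - b * -T) ^ 2 * H b := by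
    have := intervalIntegral.integral_comp_neg (a := -1) (b := 1)
      fun b => (1 - T ^ 2) / (1 - b * T) ^ 2 * H b
    rw [neg_neg] at this
    rw [← this]
    refine intervalIntegral.integral_congr fun b _ => ?_
    simp only [hH, evenQuad, neg_sq, neg_mul, mul_neg]
  have hI1 := intervalIntegrable_of_continuousOn_Icc (hgc.mul hHc)
  have hI2 := intervalIntegrable_of_continuousOn_Icc (hgc'.mul hHc)
  have hadd := intervalIntegral.integral_add hI1 hI2
  simp only [Pi.mul_apply] at hadd
  rw [← hneg] at hadd
  have h4 : ∫ b in (-1 : ℝ)..1, ((1 - T ^ 2) / (1 - b * T) ^ 2 * H b +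
      (1 - T ^ 2) / (1 - b * -T) ^ 2 * H b) = 2 * ∫ b in (-1 : ℝ)..1, evenWeight T b * H b := by
    rw [← intervalIntegral.integral_const_mul]
    refine intervalIntegral.integral_congr fun b hb => ?_
    rw [hu] at hb
    have h5 := one_sub_mul_pos hT hb
    have h6 := one_sub_mul_pos (T := -T) (by rwa [abs_neg]) hb
    have h7 : 1 - T ^ 2 * b ^ 2 = (1 - b * T) * (1 - b * -T) := by ring
    simp only [evenWeight, h7]
    generalize hD : 1 - b * T = D at *
    generalize hE : 1 - b * -T = E at *
    field_simp
    rw [← hD, ← hE]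
    ring
  have h8 : ∫ b in (-1 : ℝ)..1, (1 - T ^ 2) / (1 - b * T) ^ 2 * H b =
      ∫ b in (-1 : ℝ)..1, evenWeight T b * H b := by
    have : ∫ b in (-1 : ℝ)..1, ((1 - T ^ 2) / (1 - b * T) ^ 2 * H b +
      (1 - T ^ 2) / (1 - b * -T) ^ 2 * H b) = _ := hadd
    linarith
  rw [h8]

/-! The integrand at `κ = 1` and `κ = 1 - T²` differs from an exact derivative by a term of
constant sign. -/

theorem continuousOn_evenWeight {T : ℝ} (hT : |T| < 1) :
    ContinuousOn (evenWeight T) (Set.Icc (-1) 1) := by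
  unfold evenWeight
  exact ContinuousOn.div (by fun_prop) (by fun_prop) fun b hb =>
    pow_ne_zero 2 (one_sub_sq_mul_sq_pos hT hb).ne'

theorem hasDerivAt_evenWeight {T b : ℝ} (h : 1 - T ^ 2 * b ^ 2 ≠ 0) :
    HasDerivAt (fun b => (1 - T ^ 2) * b / (1 - T ^ 2 * b ^ 2)) (evenWeight T b) b := by
  have h1 : HasDerivAt (fun b : ℝ => 1 - T ^ 2 * b ^ 2) (-(T ^ 2 * (2 * b))) b := by
    simpa using ((hasDerivAt_pow 2 b).const_mul (T ^ 2)).const_sub 1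
  have h2 := ((hasDerivAt_id b).const_mul (1 - T ^ 2)).div h1 h
  convert! h2 using 1
  simp only [id, evenWeight]
  congr 1
  ring

/-- The deviation from exactness at `κ = 1`. -/
def upperRem (T b : ℝ) : ℝ :=
  T ^ 2 * (1 - T ^ 2) ^ 2 * b ^ 2 * (1 - b ^ 2) ^ 2 /
    (2 * (1 - T ^ 2 * b ^ 2) * (((2 - T ^ 2 - b ^ 2) * (1 - T ^ 2 * b ^ 2)) *
      √((2 - T ^ 2 - b ^ 2) * (1 - T ^ 2 * b ^ 2))))

theorem hasDerivAt_upper {T b : ℝ} (hT : |T| < 1) (hb : b ∈ Set.Icc (-1) 1) :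
    HasDerivAt (fun b => (1 - T ^ 2) * b / (1 - T ^ 2 * b ^ 2) *
      (2 - (1 + T ^ 2) * b ^ 2) / (2 * √((2 - T ^ 2 - b ^ 2) * (1 - T ^ 2 * b ^ 2))))
      (evenWeight T b * (1 * (1 - b ^ 2) /
        √(evenQuad T (1 + (1 - T ^ 2)) b * evenQuad T 1 b)) - upperRem T b) b := by
  have hm := one_sub_sq_pos hT
  have hq1 := one_sub_sq_mul_sq_pos hT hb
  have hb2 : 0 ≤ 1 - b ^ 2 := by nlinarith [hb.1, hb.2]
  have hq2 : 0 < 2 - T ^ 2 - b ^ 2 := by linarith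
  have hq := mul_pos hq2 hq1
  have d1 := hasDerivAt_evenWeight hq1.ne'
  have d2 : HasDerivAt (fun b : ℝ => 2 - (1 + T ^ 2) * b ^ 2) (-((1 + T ^ 2) * (2 * b))) b := by
    simpa using ((hasDerivAt_pow 2 b).const_mul (1 + T ^ 2)).const_sub 2
  have d3 : HasDerivAt (fun b : ℝ => 1 - T ^ 2 * b ^ 2) (-(T ^ 2 * (2 * b))) b := by
    simpa using ((hasDerivAt_pow 2 b).const_mul (T ^ 2)).const_sub 1
  have d4 : HasDerivAt (fun b : ℝ => 2 - T ^ 2 - b ^ 2) (-(2 * b)) b := by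
    simpa using (hasDerivAt_pow 2 b).const_sub (2 - T ^ 2)
  have d5 := ((d4.mul d3).sqrt hq.ne').const_mul 2
  have d6 := (d1.mul d2).div d5 (by simp only [Pi.mul_apply]; positivity)
  convert! d6 using 1
  have e1 : evenQuad T (1 + (1 - T ^ 2)) b = 2 - T ^ 2 - b ^ 2 := by rw [evenQuad]; ring
  have e2 : evenQuad T 1 b = 1 - T ^ 2 * b ^ 2 := by rw [evenQuad]; ring
  simp only [Pi.mul_apply]
  rw [e1, e2, upperRem, evenWeight]
  have hs := Real.sqrt_pos.2 hq
  have hs2 := Real.sq_sqrt hq.le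
  generalize √((2 - T ^ 2 - b ^ 2) * (1 - T ^ 2 * b ^ 2)) = S at *
  generalize hp : 1 - T ^ 2 * b ^ 2 = p at *
  generalize hr : 2 - T ^ 2 - b ^ 2 = q at *
  field_simp
  rw [hs2, ← hp, ← hr]
  ring

theorem upperRem_nonneg {T b : ℝ} (hT : |T| < 1) (hb : b ∈ Set.Icc (-1) 1) :
    0 ≤ upperRem T b := by
  have hm := one_sub_sq_pos hT
  have hq1 := one_sub_sq_mul_sq_pos hT hb
  have hb2 : 0 ≤ 1 - b ^ 2 := by nlinarith [hb.1, hb.2]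
  have hq2 : 0 < 2 - T ^ 2 - b ^ 2 := by linarith
  rw [upperRem]
  positivity

theorem continuousOn_upperRem {T : ℝ} (hT : |T| < 1) :
    ContinuousOn (upperRem T) (Set.Icc (-1) 1) := by
  unfold upperRem
  refine ContinuousOn.div (by fun_prop) (Continuous.continuousOn (by fun_prop)) fun b hb => ?_
  have hm := one_sub_sq_pos hT
  have hq1 := one_sub_sq_mul_sq_pos hT hb
  have hb2 : 0 ≤ 1 - b ^ 2 := by nlinarith [hb.1, hb.2]
  have hq2 : 0 < 2 - T ^ 2 - b ^ 2 := by linarith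
  positivity

theorem balanceMean_one {T : ℝ} (hT : |T| < 1) :
    balanceMean T 1 = 1 / 2 + (1 / 2) * ∫ b in (-1 : ℝ)..1, upperRem T b := by
  have hm := one_sub_sq_pos hT
  have hu : Set.uIcc (-1 : ℝ) 1 = Set.Icc (-1) 1 := Set.uIcc_of_le (by norm_num)
  have hF : ContinuousOn (fun b => evenWeight T b * (1 * (1 - b ^ 2) /
        √(evenQuad T (1 + (1 - T ^ 2)) b * evenQuad T 1 b))) (Set.Icc (-1) 1) := by
    refine (continuousOn_evenWeight hT).mul (ContinuousOn.div (by fun_prop)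
      (Continuous.continuousOn (by unfold evenQuad; fun_prop)) fun b hb => ?_)
    have := evenQuad_pos hT one_pos hb
    have := evenQuad_pos hT (add_pos one_pos hm) hb
    positivity
  have hI := intervalIntegrable_of_continuousOn_Icc hF
  have hR := intervalIntegrable_of_continuousOn_Icc (continuousOn_upperRem hT)
  have h := intervalIntegral.integral_eq_sub_of_hasDerivAt
    (fun b hb => hasDerivAt_upper hT (by rwa [hu] at hb)) (hI.sub hR)
  rw [intervalIntegral.integral_sub hI hR] at h
  have hs : √((2 - T ^ 2 - 1) * (1 - T ^ 2)) = 1 - T ^ 2 := by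
    rw [show (2 - T ^ 2 - 1) * (1 - T ^ 2) = (1 - T ^ 2) ^ 2 by ring, Real.sqrt_sq hm.le]
  norm_num only [mul_one, mul_neg, neg_sq, one_pow] at h
  rw [hs, show 2 - (1 + T ^ 2) = 1 - T ^ 2 by ring] at h
  rw [balanceMean_eq_even hT one_pos]
  have h2 : (1 - T ^ 2) / (1 - T ^ 2) * (1 - T ^ 2) / (2 * (1 - T ^ 2)) = 1 / 2 := by
    field_simp
  have h3 : -(1 - T ^ 2) / (1 - T ^ 2) * (1 - T ^ 2) / (2 * (1 - T ^ 2)) = -(1 / 2) := by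
    field_simp
  rw [h2, h3] at h
  linarith

theorem half_le_balanceMean_one {T : ℝ} (hT : |T| < 1) : 1 / 2 ≤ balanceMean T 1 := by
  rw [balanceMean_one hT]
  have := intervalIntegral.integral_nonneg (μ := volume) (by norm_num : (-1 : ℝ) ≤ 1)
    fun b hb => upperRem_nonneg hT hb
  linarith

theorem half_lt_balanceMean_one {T : ℝ} (hT : |T| < 1) (h0 : T ≠ 0) : 1 / 2 < balanceMean T 1 := by
  rw [balanceMean_one hT]
  have := intervalIntegral.integral_pos (by norm_num : (-1 : ℝ) < 1) (continuousOn_upperRem hT)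
    (fun b hb => upperRem_nonneg hT (Set.Ioc_subset_Icc_self hb)) ⟨1 / 2, by norm_num, by
      have hm := one_sub_sq_pos hT
      have hq1 := one_sub_sq_mul_sq_pos hT (b := 1 / 2) (by norm_num)
      have hq2 : 0 < 2 - T ^ 2 - (1 / 2 : ℝ) ^ 2 := by linarith
      rw [upperRem]
      have : (0 : ℝ) < 1 - (1 / 2) ^ 2 := by norm_num
      positivity⟩
  linarith

/-- The deviation from exactness at `κ = 1 - T²`. -/
def lowerRem (T b : ℝ) : ℝ :=
  T ^ 2 * b ^ 2 * (1 - b ^ 2) * (3 - b ^ 2) /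
    ((1 - T ^ 2 * b ^ 2) * ((2 - b ^ 2) * √(2 - b ^ 2)))

theorem hasDerivAt_lower {T b : ℝ} (hT : |T| < 1) (hb : b ∈ Set.Icc (-1) 1) :
    HasDerivAt (fun b => 1 / 2 * b * √(2 - b ^ 2) +
      ((1 - T ^ 2) * b / (1 - T ^ 2 * b ^ 2) - b) * ((1 - b ^ 2) / √(2 - b ^ 2)))
      (evenWeight T b * ((1 - b ^ 2) / √(2 - b ^ 2)) + lowerRem T b) b := by
  have hm := one_sub_sq_pos hT
  have hq1 := one_sub_sq_mul_sq_pos hT hb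
  have hb2 : 0 ≤ 1 - b ^ 2 := by nlinarith [hb.1, hb.2]
  have hq2 : 0 < 2 - b ^ 2 := by linarith
  have d1 := hasDerivAt_evenWeight hq1.ne'
  have d2 : HasDerivAt (fun b : ℝ => 1 - b ^ 2) (-(2 * b)) b := by
    simpa using (hasDerivAt_pow 2 b).const_sub 1
  have d4 : HasDerivAt (fun b : ℝ => 2 - b ^ 2) (-(2 * b)) b := by
    simpa using (hasDerivAt_pow 2 b).const_sub 2
  have d5 := d4.sqrt hq2.ne'
  have d6 := (((hasDerivAt_id b).const_mul (1 / 2)).mul d5).add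
    ((d1.sub (hasDerivAt_id b)).mul (d2.div d5 (by positivity)))
  convert! d6 using 1
  simp only [Pi.sub_apply, id, Pi.div_apply]
  rw [lowerRem, evenWeight]
  have hs := Real.sqrt_pos.2 hq2
  have hs2 := Real.sq_sqrt hq2.le
  generalize √(2 - b ^ 2) = S at *
  generalize hp : 1 - T ^ 2 * b ^ 2 = p at *
  generalize hr : 2 - b ^ 2 = q at *
  field_simp
  simp only [hs2, ← hp, ← hr]
  ring

theorem lowerRem_nonneg {T b : ℝ} (hT : |T| < 1) (hb : b ∈ Set.Icc (-1) 1) :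
    0 ≤ lowerRem T b := by
  have hq1 := one_sub_sq_mul_sq_pos hT hb
  have hb2 : 0 ≤ 1 - b ^ 2 := by nlinarith [hb.1, hb.2]
  have hq2 : 0 < 2 - b ^ 2 := by linarith
  have hq3 : 0 < 3 - b ^ 2 := by linarith
  rw [lowerRem]
  positivity

theorem balanceMean_one_sub_sq_le {T : ℝ} (hT : |T| < 1) : balanceMean T (1 - T ^ 2) ≤ 1 / 2 := by
  have hm := one_sub_sq_pos hT
  have hu : Set.uIcc (-1 : ℝ) 1 = Set.Icc (-1) 1 := Set.uIcc_of_le (by norm_num)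
  have hq : ∀ b ∈ Set.Icc (-1 : ℝ) 1, 0 < 2 - b ^ 2 := fun b hb => by nlinarith [hb.1, hb.2]
  have hF : ContinuousOn (fun b => evenWeight T b * ((1 - b ^ 2) / √(2 - b ^ 2)))
      (Set.Icc (-1) 1) := by
    refine (continuousOn_evenWeight hT).mul (ContinuousOn.div (by fun_prop)
      (Continuous.continuousOn (by fun_prop)) fun b hb => ?_)
    have := hq b hb
    positivity
  have hRc : ContinuousOn (lowerRem T) (Set.Icc (-1) 1) := by
    unfold lowerRem
    refine ContinuousOn.div (by fun_prop) (Continuous.continuousOn (by fun_prop)) fun b hb => ?_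
    have := hq b hb
    have := one_sub_sq_mul_sq_pos hT hb
    positivity
  have hI := intervalIntegrable_of_continuousOn_Icc hF
  have hR := intervalIntegrable_of_continuousOn_Icc hRc
  have h := intervalIntegral.integral_eq_sub_of_hasDerivAt
    (fun b hb => hasDerivAt_lower hT (by rwa [hu] at hb)) (hI.add hR)
  rw [intervalIntegral.integral_add hI hR] at h
  norm_num [Real.sqrt_one] at h
  have h0 := intervalIntegral.integral_nonneg (μ := volume) (by norm_num : (-1 : ℝ) ≤ 1)
    fun b hb => lowerRem_nonneg hT hb
  rw [balanceMean_eq_even hT hm]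
  have h2 : ∫ b in (-1 : ℝ)..1, evenWeight T b * ((1 - T ^ 2) * (1 - b ^ 2) /
      √(evenQuad T ((1 - T ^ 2) + (1 - T ^ 2)) b * evenQuad T (1 - T ^ 2) b)) =
      ∫ b in (-1 : ℝ)..1, evenWeight T b * ((1 - b ^ 2) / √(2 - b ^ 2)) := by
    refine intervalIntegral.integral_congr fun b hb => ?_
    rw [hu] at hb
    have e1 : evenQuad T ((1 - T ^ 2) + (1 - T ^ 2)) b * evenQuad T (1 - T ^ 2) b =
        (1 - T ^ 2) ^ 2 * (2 - b ^ 2) := by rw [evenQuad, evenQuad]; ring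
    rw [e1, Real.sqrt_mul (by positivity), Real.sqrt_sq hm.le, mul_div_mul_left _ _ hm.ne']
  rw [h2]
  linarith

end BaryExt
end

noncomputable section
namespace BaryExt

/-! ### Complexification of the mean -/

theorem continuous_of_continuousOn_uncurry {X E G : Type*} [TopologicalSpace X]
    [TopologicalSpace E] [TopologicalSpace G] {f : E → X → G} {U : Set E}
    (hf : ContinuousOn f.uncurry (U ×ˢ Set.univ)) {q : E} (hq : q ∈ U) : Continuous (f q) :=
  continuousOn_univ.1 (hf.comp (f := fun x => (q, x)) (by fun_prop)
    fun x _ => ⟨hq, Set.mem_univ x⟩)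

/-- Integrals of continuously differentiable families over a compact space are continuously
differentiable. -/
theorem contDiffAt_integral_of_compactSpace {X E : Type*} [TopologicalSpace X] [CompactSpace X]
    [SecondCountableTopology X] [MeasurableSpace X] [BorelSpace X] {μ : Measure X}
    [IsFiniteMeasure μ] [NormedAddCommGroup E] [NormedSpace ℂ E] [LocallyCompactSpace E]
    {F : E → X → ℂ} {F' : E → X → E →L[ℂ] ℂ} {U : Set E} (hU : IsOpen U)
    (hF : ContinuousOn F.uncurry (U ×ˢ Set.univ))
    (hF' : ContinuousOn F'.uncurry (U ×ˢ Set.univ))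
    (hd : ∀ p ∈ U, ∀ x, HasFDerivAt (F · x) (F' p x) p) {p : E} (hp : p ∈ U) :
    ContDiffAt ℂ 1 (fun p => ∫ x, F p x ∂μ) p ∧
      HasFDerivAt (fun p => ∫ x, F p x ∂μ) (∫ x, F' p x ∂μ) p := by
  have hderiv : ∀ q ∈ U, HasFDerivAt (fun p => ∫ x, F p x ∂μ) (∫ x, F' q x ∂μ) q := by
    intro q hq
    obtain ⟨k, hk, hkU, hkc⟩ := local_compact_nhds (hU.mem_nhds hq)
    obtain ⟨C, hC⟩ := (hkc.prod isCompact_univ).exists_bound_of_continuousOn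
      (hF'.mono (Set.prod_mono hkU subset_rfl))
    refine hasFDerivAt_integral_of_dominated_of_fderiv_le (s := k) (bound := fun _ => C) hk
      ?_ ?_ ?_ ?_ (integrable_const C) ?_
    · filter_upwards [hU.mem_nhds hq] with q hq
      exact (continuous_of_continuousOn_uncurry hF hq).aestronglyMeasurable
    · exact (continuous_of_continuousOn_uncurry hF hq).integrable_of_hasCompactSupport
        (HasCompactSupport.of_compactSpace _)
    · exact (continuous_of_continuousOn_uncurry hF' hq).aestronglyMeasurable
    · exact ae_of_all _ fun x q hq => hC (q, x) ⟨hq, Set.mem_univ x⟩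
    · exact ae_of_all _ fun x q hq => hd q (hkU hq) x
  refine ⟨contDiffAt_one_iff.2 ⟨fun q => ∫ x, F' q x ∂μ, U, hU.mem_nhds hp, ?_, hderiv⟩,
    hderiv p hp⟩
  exact continuousOn_integral_of_compact_support isCompact_univ hF'
    fun _ x _ h => absurd (Set.mem_univ x) h

/-- `balanceDenom` for complex parameters. -/
def complexDenom (p : ℂ × ℂ) (ζ : S2) : ℂ :=
  ((ζ.1 0 : ℂ) + p.1) ^ 2 + (1 - p.1 ^ 2) * (ζ.1 2 : ℂ) ^ 2 + p.2 * (1 - (ζ.1 0 : ℂ) ^ 2)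

/-- `balanceKernel` for complex parameters. -/
def complexKernel (p : ℂ × ℂ) (ζ : S2) : ℂ :=
  p.2 * (1 - (ζ.1 0 : ℂ) ^ 2) * (complexDenom p ζ)⁻¹

/-- `balanceMean` for complex parameters. -/
def complexMean (p : ℂ × ℂ) : ℂ := ∫ ζ, complexKernel p ζ ∂sphereMeasure

/-- The derivative of `complexKernel` in the parameters. -/
def complexKernelDeriv (p : ℂ × ℂ) (ζ : S2) : ℂ × ℂ →L[ℂ] ℂ :=
  (p.2 * (1 - (ζ.1 0 : ℂ) ^ 2)) • (-(complexDenom p ζ ^ 2)⁻¹ •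
    ((2 * ((ζ.1 0 : ℂ) + p.1) - 2 * p.1 * (ζ.1 2 : ℂ) ^ 2) • ContinuousLinearMap.fst ℂ ℂ ℂ +
      (1 - (ζ.1 0 : ℂ) ^ 2) • ContinuousLinearMap.snd ℂ ℂ ℂ)) +
  (complexDenom p ζ)⁻¹ • ((1 - (ζ.1 0 : ℂ) ^ 2) • ContinuousLinearMap.snd ℂ ℂ ℂ)

theorem hasFDerivAt_complexKernel {p : ℂ × ℂ} {ζ : S2} (h : complexDenom p ζ ≠ 0) :
    HasFDerivAt (complexKernel · ζ) (complexKernelDeriv p ζ) p := by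
  have h1 : HasFDerivAt (fun p : ℂ × ℂ => p.1) (ContinuousLinearMap.fst ℂ ℂ ℂ) p := hasFDerivAt_fst
  have h2 : HasFDerivAt (fun p : ℂ × ℂ => p.2) (ContinuousLinearMap.snd ℂ ℂ ℂ) p := hasFDerivAt_snd
  have hD : HasFDerivAt (complexDenom · ζ)
      ((2 * ((ζ.1 0 : ℂ) + p.1) - 2 * p.1 * (ζ.1 2 : ℂ) ^ 2) • ContinuousLinearMap.fst ℂ ℂ ℂ +
      (1 - (ζ.1 0 : ℂ) ^ 2) • ContinuousLinearMap.snd ℂ ℂ ℂ) p := by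
    have := (((h1.const_add (ζ.1 0 : ℂ)).pow 2).add
      (((h1.pow 2).const_sub 1).mul_const ((ζ.1 2 : ℂ) ^ 2))).add
      (h2.mul_const (1 - (ζ.1 0 : ℂ) ^ 2))
    convert! this using 1
    ext
    · simp
      ring
    · simp
  have hN : HasFDerivAt (fun p : ℂ × ℂ => p.2 * (1 - (ζ.1 0 : ℂ) ^ 2))
      ((1 - (ζ.1 0 : ℂ) ^ 2) • ContinuousLinearMap.snd ℂ ℂ ℂ) p := h2.mul_const _
  exact hN.mul ((hasDerivAt_inv h).comp_hasFDerivAt p hD)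

/-- The parameters for which `complexKernel` has no poles. -/
def regularParam : Set (ℂ × ℂ) := {p | ∀ ζ : S2, complexDenom p ζ ≠ 0}

theorem continuous_complexDenom : Continuous complexDenom.uncurry := by
  have h (i) : Continuous fun q : (ℂ × ℂ) × S2 => ((q.2.1 i : ℝ) : ℂ) :=
    Complex.continuous_ofReal.comp ((continuous_apply_S2 i).comp continuous_snd)
  have h0 := h 0
  have h2 := h 2
  unfold complexDenom Function.uncurry
  fun_prop

theorem isOpen_regularParam : IsOpen regularParam := by
  rw [isOpen_iff_eventually]
  intro p hp
  have := isCompact_univ.eventually_forall_of_forall_eventually (x₀ := p) (K := (Set.univ : Set S2))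
    (P := fun p ζ => complexDenom p ζ ≠ 0)
    fun ζ _ => continuous_complexDenom.continuousAt.eventually_ne (hp ζ)
  exact this.mono fun q hq ζ => hq ζ (Set.mem_univ ζ)

theorem ofReal_mem_regularParam {T κ : ℝ} (hT : |T| < 1) (hκ : 0 < κ) :
    ((T : ℂ), (κ : ℂ)) ∈ regularParam := fun ζ => by
  have h : complexDenom ((T : ℂ), (κ : ℂ)) ζ = (balanceDenom T κ ζ : ℝ) := by
    simp [complexDenom, balanceDenom]
  rw [h]
  exact_mod_cast (balanceDenom_pos hT hκ ζ).ne'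

theorem complexMean_ofReal (T κ : ℝ) : complexMean (T, κ) = balanceMean T κ := by
  rw [complexMean, balanceMean, ← integral_complex_ofReal]
  congr 1
  ext ζ
  simp [complexKernel, complexDenom, balanceKernel, balanceDenom, div_eq_mul_inv]

theorem continuous_ofReal_apply_S2 (i : Fin 3) :
    Continuous fun q : (ℂ × ℂ) × S2 => ((q.2.1 i : ℝ) : ℂ) :=
  Complex.continuous_ofReal.comp ((continuous_apply_S2 i).comp continuous_snd)

theorem continuousOn_complexKernel :
    ContinuousOn complexKernel.uncurry (regularParam ×ˢ Set.univ) := by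
  have h0 := continuous_ofReal_apply_S2 0
  have hc : Continuous fun q : (ℂ × ℂ) × S2 => q.1.2 * (1 - (q.2.1 0 : ℂ) ^ 2) := by fun_prop
  exact hc.continuousOn.mul (continuous_complexDenom.continuousOn.inv₀ fun q hq => hq.1 q.2)

theorem continuousOn_complexKernelDeriv :
    ContinuousOn complexKernelDeriv.uncurry (regularParam ×ˢ Set.univ) := by
  have h0 := continuous_ofReal_apply_S2 0
  have h2 := continuous_ofReal_apply_S2 2
  have hD : ContinuousOn (fun q : (ℂ × ℂ) × S2 => complexDenom q.1 q.2)
      (regularParam ×ˢ Set.univ) := continuous_complexDenom.continuousOn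
  have hne : ∀ q ∈ regularParam ×ˢ (Set.univ : Set S2), complexDenom q.1 q.2 ≠ 0 :=
    fun q hq => hq.1 q.2
  have hi := hD.inv₀ hne
  have hi2 := (hD.pow 2).inv₀ fun q hq => pow_ne_zero 2 (hne q hq)
  have hc1 : Continuous fun q : (ℂ × ℂ) × S2 => q.1.2 * (1 - (q.2.1 0 : ℂ) ^ 2) := by fun_prop
  have hc2 : Continuous fun q : (ℂ × ℂ) × S2 =>
      (1 - (q.2.1 0 : ℂ) ^ 2) • ContinuousLinearMap.snd ℂ ℂ ℂ := by fun_prop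
  have hc3 : Continuous fun q : (ℂ × ℂ) × S2 =>
      (2 * ((q.2.1 0 : ℂ) + q.1.1) - 2 * q.1.1 * (q.2.1 2 : ℂ) ^ 2) •
        ContinuousLinearMap.fst ℂ ℂ ℂ := by fun_prop
  exact (hc1.continuousOn.smul (hi2.neg.smul (hc3.add hc2).continuousOn)).add
    (hi.smul hc2.continuousOn)

theorem contDiffAt_complexMean {p : ℂ × ℂ} (hp : p ∈ regularParam) :
    ContDiffAt ℂ 1 complexMean p ∧
      HasFDerivAt complexMean (∫ ζ, complexKernelDeriv p ζ ∂sphereMeasure) p :=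
  contDiffAt_integral_of_compactSpace isOpen_regularParam continuousOn_complexKernel
    continuousOn_complexKernelDeriv (fun _ hq ζ => hasFDerivAt_complexKernel (hq ζ)) hp

theorem continuousAt_balanceMean {T κ : ℝ} (hT : |T| < 1) (hκ : 0 < κ) :
    ContinuousAt (fun p : ℝ × ℝ => balanceMean p.1 p.2) (T, κ) := by
  have h : (fun p : ℝ × ℝ => balanceMean p.1 p.2) =
      fun p => (complexMean (((p.1 : ℝ) : ℂ), ((p.2 : ℝ) : ℂ))).re := by
    ext p; rw [complexMean_ofReal, Complex.ofReal_re]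
  rw [h]
  have hc : ContinuousAt (fun p : ℝ × ℝ => (((p.1 : ℝ) : ℂ), ((p.2 : ℝ) : ℂ))) (T, κ) := by
    fun_prop
  exact Complex.continuous_re.continuousAt.comp (ContinuousAt.comp (g := complexMean)
    (contDiffAt_complexMean (ofReal_mem_regularParam hT hκ)).1.continuousAt hc)

theorem balanceDenom_northPole (T κ : ℝ) : balanceDenom T κ northPole = 1 + κ := by
  simp [balanceDenom, northPole]

theorem balanceMean_strictMonoOn {T : ℝ} (hT : |T| < 1) :
    StrictMonoOn (balanceMean T) (Set.Ioi 0) := by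
  intro κ hκ κ' hκ' h
  have hc := continuous_balanceKernel hT hκ
  have hc' := continuous_balanceKernel hT hκ'
  have hI := integrable_of_continuous_S2 (μ := sphereMeasure) hc
  have hI' := integrable_of_continuous_S2 (μ := sphereMeasure) hc'
  rw [← sub_pos, balanceMean, balanceMean, ← integral_sub hI' hI]
  have hm := one_sub_sq_pos hT
  have key : ∀ ζ : S2, balanceKernel T κ' ζ - balanceKernel T κ ζ =
      (κ' - κ) * (1 - ζ.1 0 ^ 2) * ((ζ.1 0 + T) ^ 2 + (1 - T ^ 2) * ζ.1 2 ^ 2) /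
        (balanceDenom T κ' ζ * balanceDenom T κ ζ) := fun ζ => by
    have h1 := balanceDenom_pos hT hκ ζ
    have h2 := balanceDenom_pos hT hκ' ζ
    rw [balanceKernel, balanceKernel]
    rw [div_sub_div _ _ h2.ne' h1.ne', balanceDenom, balanceDenom]
    congr 1
    ring
  refine (hc'.sub hc).integral_pos_of_hasCompactSupport_nonneg_nonzero
    (HasCompactSupport.of_compactSpace _) (fun ζ => ?_) (x := northPole) ?_
  · have h1 := balanceDenom_pos hT hκ ζ
    have h2 := balanceDenom_pos hT hκ' ζ
    have h3 : 0 ≤ 1 - ζ.1 0 ^ 2 := by linarith [apply_sq_le_one ζ 0]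
    have h4 : 0 ≤ κ' - κ := by linarith
    simp only [Pi.zero_apply, key]
    positivity
  · rw [key, balanceDenom_northPole, balanceDenom_northPole]
    have h1 : 0 < κ' - κ := by linarith
    have h2 : 0 < κ := hκ
    have h3 : 0 < κ' := hκ'
    have : (κ' - κ) * (1 - (0 : ℝ) ^ 2) * ((0 + T) ^ 2 + (1 - T ^ 2) * 1 ^ 2) = κ' - κ := by ring
    simp only [northPole, Matrix.cons_val]
    rw [this]
    positivity

end BaryExt
end

noncomputable section
namespace BaryExt

/-! ### The solution of the scalar equation -/

theorem exists_balanceMean_eq_half {T : ℝ} (hT : |T| < 1) :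
    ∃ κ ∈ Set.Icc (1 - T ^ 2) 1, balanceMean T κ = 1 / 2 := by
  have hm := one_sub_sq_pos hT
  have hc : ContinuousOn (balanceMean T) (Set.Icc (1 - T ^ 2) 1) := fun κ hκ =>
    ((continuousAt_balanceMean hT (hm.trans_le hκ.1)).comp (f := fun κ => (T, κ))
      (by fun_prop)).continuousWithinAt
  exact intermediate_value_Icc (by nlinarith) hc
    ⟨balanceMean_one_sub_sq_le hT, half_le_balanceMean_one hT⟩

/-- The parameter `κ > 0` with `balanceMean T κ = 1 / 2`. -/
def balanceParam (T : ℝ) : ℝ := Classical.epsilon fun κ => 0 < κ ∧ balanceMean T κ = 1 / 2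

theorem balanceParam_spec {T : ℝ} (hT : |T| < 1) :
    0 < balanceParam T ∧ balanceMean T (balanceParam T) = 1 / 2 := by
  obtain ⟨κ, hκ, h⟩ := exists_balanceMean_eq_half hT
  exact Classical.epsilon_spec (p := fun κ => 0 < κ ∧ balanceMean T κ = 1 / 2)
    ⟨κ, (one_sub_sq_pos hT).trans_le hκ.1, h⟩

theorem lt_balanceParam_iff {T κ : ℝ} (hT : |T| < 1) (hκ : 0 < κ) :
    κ < balanceParam T ↔ balanceMean T κ < 1 / 2 := by
  obtain ⟨h0, h⟩ := balanceParam_spec hT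
  rw [← h]
  exact ((balanceMean_strictMonoOn hT).lt_iff_lt hκ h0).symm

theorem balanceParam_lt_iff {T κ : ℝ} (hT : |T| < 1) (hκ : 0 < κ) :
    balanceParam T < κ ↔ 1 / 2 < balanceMean T κ := by
  obtain ⟨h0, h⟩ := balanceParam_spec hT
  rw [← h]
  exact ((balanceMean_strictMonoOn hT).lt_iff_lt h0 hκ).symm

theorem balanceParam_mem_Icc {T : ℝ} (hT : |T| < 1) :
    balanceParam T ∈ Set.Icc (1 - T ^ 2) 1 := by
  constructor
  · rw [← not_lt, balanceParam_lt_iff hT (one_sub_sq_pos hT), not_lt]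
    exact balanceMean_one_sub_sq_le hT
  · rw [← not_lt, lt_balanceParam_iff hT one_pos, not_lt]
    exact half_le_balanceMean_one hT

theorem balanceParam_zero : balanceParam 0 = 1 := by
  have h := balanceParam_mem_Icc (T := 0) (by simp)
  simp only [ne_eq, OfNat.ofNat_ne_zero, not_false_eq_true, zero_pow, sub_zero] at h
  exact le_antisymm h.2 h.1

theorem balanceParam_lt_one {T : ℝ} (hT : |T| < 1) (h0 : T ≠ 0) : balanceParam T < 1 :=
  (balanceParam_lt_iff hT one_pos).2 (half_lt_balanceMean_one hT h0)

theorem eventually_abs_lt_one {T : ℝ} (hT : |T| < 1) : ∀ᶠ T' : ℝ in 𝓝 T, |T'| < 1 :=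
  continuous_abs.continuousAt.eventually_lt_const hT

theorem continuousAt_balanceParam {T : ℝ} (hT : |T| < 1) : ContinuousAt balanceParam T := by
  have hc {κ : ℝ} (hκ : 0 < κ) : ContinuousAt (fun T => balanceMean T κ) T :=
    (continuousAt_balanceMean hT hκ).comp (f := fun T => (T, κ)) (by fun_prop)
  refine tendsto_order.2 ⟨fun a ha => ?_, fun b hb => ?_⟩
  · rcases le_or_gt a 0 with h0 | h0
    · filter_upwards [eventually_abs_lt_one hT] with T' hT'
      exact h0.trans_lt (balanceParam_spec hT').1
    · filter_upwards [eventually_abs_lt_one hT,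
        (hc h0).eventually_lt_const ((lt_balanceParam_iff hT h0).1 ha)] with T' hT' h
      exact (lt_balanceParam_iff hT' h0).2 h
  · have h0 : 0 < b := (balanceParam_spec hT).1.trans hb
    filter_upwards [eventually_abs_lt_one hT,
      (hc h0).eventually_const_lt ((balanceParam_lt_iff hT h0).1 hb)] with T' hT' h
    exact (balanceParam_lt_iff hT' h0).2 h

/-! ### Analyticity -/

theorem deriv_complexMean_ne_zero {T κ : ℝ} (hT : |T| < 1) (hκ : 0 < κ) :
    (∫ ζ, complexKernelDeriv (T, κ) ζ ∂sphereMeasure) (0, 1) ≠ 0 := by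
  have hp := ofReal_mem_regularParam hT hκ
  have hc := continuous_of_continuousOn_uncurry continuousOn_complexKernelDeriv hp
  rw [ContinuousLinearMap.integral_apply (hc.integrable_of_hasCompactSupport
    (HasCompactSupport.of_compactSpace _))]
  have hm := one_sub_sq_pos hT
  set g : S2 → ℝ := fun ζ => (1 - ζ.1 0 ^ 2) *
    ((ζ.1 0 + T) ^ 2 + (1 - T ^ 2) * ζ.1 2 ^ 2) / balanceDenom T κ ζ ^ 2 with hg
  have h (ζ : S2) : complexKernelDeriv (T, κ) ζ (0, 1) = g ζ := by
    have h1 : complexDenom ((T : ℂ), (κ : ℂ)) ζ = (balanceDenom T κ ζ : ℝ) := by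
      simp [complexDenom, balanceDenom]
    have h2 := (balanceDenom_pos hT hκ ζ).ne'
    have h3 : g ζ = κ * (1 - ζ.1 0 ^ 2) * (-(balanceDenom T κ ζ ^ 2)⁻¹ * (1 - ζ.1 0 ^ 2)) +
        (balanceDenom T κ ζ)⁻¹ * (1 - ζ.1 0 ^ 2) := by
      have h4 : (ζ.1 0 + T) ^ 2 + (1 - T ^ 2) * ζ.1 2 ^ 2 =
        balanceDenom T κ ζ - κ * (1 - ζ.1 0 ^ 2) := by rw [balanceDenom]; ring
      rw [hg]
      simp only [h4]
      field_simp
      ring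
    rw [h3, complexKernelDeriv, h1]
    simp
  have h0 := continuous_apply_S2 0
  have h2 := continuous_apply_S2 2
  have hgc : Continuous g := by
    refine Continuous.div (by fun_prop) (by unfold balanceDenom; fun_prop)
      fun ζ => pow_ne_zero 2 (balanceDenom_pos hT hκ ζ).ne'
  simp only [h]
  rw [integral_complex_ofReal]
  refine Complex.ofReal_ne_zero.2 (ne_of_gt ?_)
  refine hgc.integral_pos_of_hasCompactSupport_nonneg_nonzero
    (HasCompactSupport.of_compactSpace _) (fun ζ => ?_) (x := northPole) ?_
  · have h3 : 0 ≤ 1 - ζ.1 0 ^ 2 := by linarith [apply_sq_le_one ζ 0]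
    simp only [Pi.zero_apply, hg]
    positivity
  · have h3 : g northPole = (1 + κ)⁻¹ ^ 2 := by
      simp only [hg, balanceDenom_northPole]
      simp [northPole]
    rw [h3]
    positivity

theorem analyticAt_balanceParam {T : ℝ} (hT : |T| < 1) : AnalyticAt ℝ balanceParam T := by
  obtain ⟨hκ, hK⟩ := balanceParam_spec hT
  have hp := ofReal_mem_regularParam hT hκ
  obtain ⟨cdf, hd⟩ := contDiffAt_complexMean hp
  have hne := deriv_complexMean_ne_zero hT hκ
  have hinv : (fderiv ℂ complexMean ((T : ℂ), (balanceParam T : ℂ)) ∘L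
      .inr ℂ ℂ ℂ).IsInvertible := by
    rw [hd.fderiv]
    refine ⟨ContinuousLinearEquiv.unitsEquivAut ℂ (Units.mk0 _ hne), ?_⟩
    ext
    simp
  set g := cdf.implicitFunction one_ne_zero hinv with hg
  have hgan : AnalyticAt ℂ g T := by
    rw [Complex.analyticAt_iff_eventually_differentiableAt]
    exact ((cdf.contDiffAt_implicitFunction one_ne_zero hinv).eventually (by simp)).mono
      fun z hz => hz.differentiableAt one_ne_zero
  refine hgan.re_ofReal.congr ?_
  have ht : Tendsto (fun T' : ℝ => ((T' : ℂ), (balanceParam T' : ℂ))) (𝓝 T)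
      (𝓝 ((T : ℂ), (balanceParam T : ℂ))) :=
    (Complex.continuous_ofReal.tendsto T).prodMk_nhds
      ((Complex.continuous_ofReal.tendsto _).comp (continuousAt_balanceParam hT))
  filter_upwards [eventually_abs_lt_one hT,
    ht.eventually (cdf.eventually_apply_eq_iff_implicitFunction one_ne_zero hinv)] with T' hT' h
  rw [complexMean_ofReal, complexMean_ofReal, hK, (balanceParam_spec hT').2] at h
  have := h.1 rfl
  rw [hg]
  rw [this, Complex.ofReal_re]

/-! ### The limit at infinity -/

theorem integral_apply_zero : ∫ ζ : S2, ζ.1 0 ∂sphereMeasure = 0 := by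
  have h := integral_comp_sphereIso (signIso (-1) 1 1 (by norm_num) (by norm_num) (by norm_num))
    (continuous_apply_S2 0)
  simp only [coe_sphereIso, signIso_zero, neg_one_mul, integral_neg] at h
  linarith

theorem balanceMean_one_left_lt {κ : ℝ} (hκ : 0 < κ) (hκ1 : κ < 1) : balanceMean 1 κ < 1 / 2 := by
  have h0 := continuous_apply_S2 0
  have hle (ζ : S2) : balanceKernel 1 κ ζ ≤
      (1 - ζ.1 0) / 2 - (1 - κ) / 4 * (1 - ζ.1 0 ^ 2) := by
    obtain ⟨h1, h2⟩ := abs_le.1 (abs_apply_le_one (norm_sphere ζ) 0)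
    rw [balanceKernel, balanceDenom]
    generalize (ζ.1 0 : ℝ) = a at *
    rcases h1.eq_or_lt with rfl | h1
    · norm_num
    have h3 : 0 < 1 + a := by linarith
    have h4 : 0 < (1 + a) + κ * (1 - a) := by nlinarith
    have h5 : (a + 1) ^ 2 + (1 - 1 ^ 2) * ζ.1 2 ^ 2 + κ * (1 - a ^ 2) =
        (1 + a) * ((1 + a) + κ * (1 - a)) := by ring
    rw [h5, show κ * (1 - a ^ 2) = (1 + a) * (κ * (1 - a)) by ring,
      mul_div_mul_left _ _ h3.ne', div_le_iff₀ h4]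
    have h6 : 0 ≤ (1 - a) * (1 + a) * (1 - κ) := by
      have : 0 ≤ 1 - a := by linarith
      have : 0 ≤ 1 - κ := by linarith
      positivity
    have h7 : (1 + a) + κ * (1 - a) ≤ 2 := by nlinarith
    nlinarith [mul_nonneg h6 (sub_nonneg.2 h7)]
  have hnn (ζ : S2) : 0 ≤ balanceKernel 1 κ ζ := by
    have h3 : 0 ≤ 1 - ζ.1 0 ^ 2 := by linarith [apply_sq_le_one ζ 0]
    rw [balanceKernel, balanceDenom]
    norm_num
    positivity
  have hI0 := integrable_of_continuous_S2 (μ := sphereMeasure) h0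
  have hI2 := integrable_of_continuous_S2 (μ := sphereMeasure)
    (show Continuous fun ζ : S2 => 1 - ζ.1 0 ^ 2 by fun_prop)
  have hI1 : Integrable (fun ζ : S2 => (1 - ζ.1 0) / 2) sphereMeasure :=
    ((integrable_const 1).sub hI0).div_const 2
  have h1 : balanceMean 1 κ ≤ ∫ ζ : S2, ((1 - ζ.1 0) / 2 - (1 - κ) / 4 * (1 - ζ.1 0 ^ 2))
      ∂sphereMeasure :=
    integral_mono_of_nonneg (ae_of_all _ hnn) (hI1.sub (hI2.const_mul _)) (ae_of_all _ hle)
  rw [integral_sub hI1 (hI2.const_mul _), integral_div, integral_sub (integrable_const 1) hI0,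
    integral_apply_zero, integral_const_mul] at h1
  have h2 : 0 < ∫ ζ : S2, (1 - ζ.1 0 ^ 2) ∂sphereMeasure := by
    have hc : Continuous fun ζ : S2 => 1 - ζ.1 0 ^ 2 := by fun_prop
    refine hc.integral_pos_of_hasCompactSupport_nonneg_nonzero
      (HasCompactSupport.of_compactSpace _) (fun ζ => ?_) (x := northPole) ?_
    · simpa using apply_sq_le_one ζ 0
    · simp [northPole]
  simp only [integral_const, probReal_univ, smul_eq_mul, mul_one, sub_zero] at h1
  nlinarith

theorem tendsto_balanceMean_one {κ : ℝ} (hκ : 0 < κ) :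
    Tendsto (fun T => balanceMean T κ) (𝓝[<] 1) (𝓝 (balanceMean 1 κ)) := by
  have hT : ∀ᶠ T : ℝ in 𝓝[<] 1, |T| < 1 := by
    filter_upwards [Ioo_mem_nhdsLT (show (-1 : ℝ) < 1 by norm_num)] with T hT
    exact abs_lt.2 hT
  refine tendsto_integral_filter_of_dominated_convergence (fun _ => 1)
    (hT.mono fun T h => (continuous_balanceKernel h hκ).aestronglyMeasurable)
    (hT.mono fun T h => ae_of_all _ fun ζ => ?_) (integrable_const 1) (ae_of_all _ fun ζ => ?_)
  · have hm := one_sub_sq_pos h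
    have hd := balanceDenom_pos h hκ ζ
    have h3 : 0 ≤ 1 - ζ.1 0 ^ 2 := by linarith [apply_sq_le_one ζ 0]
    have h4 : 0 ≤ balanceKernel T κ ζ := by rw [balanceKernel]; positivity
    rw [Real.norm_of_nonneg h4, balanceKernel, div_le_one hd, balanceDenom]
    have : 0 ≤ (ζ.1 0 + T) ^ 2 + (1 - T ^ 2) * ζ.1 2 ^ 2 := by positivity
    linarith
  · by_cases h : ζ.1 0 ^ 2 = 1
    · simp only [balanceKernel, h, sub_self, mul_zero, zero_div]
      exact tendsto_const_nhds
    · have h3 : 0 < 1 - ζ.1 0 ^ 2 :=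
        sub_pos.2 (lt_of_le_of_ne (apply_sq_le_one ζ 0) h)
      have h4 : balanceDenom 1 κ ζ ≠ 0 := by
        rw [balanceDenom]
        norm_num
        positivity
      have : ContinuousAt (fun T => balanceKernel T κ ζ) 1 := by
        unfold balanceKernel
        exact continuousAt_const.div (by unfold balanceDenom; fun_prop) h4
      exact this.tendsto.mono_left nhdsWithin_le_nhds

theorem tendsto_balanceParam_one : Tendsto balanceParam (𝓝[<] 1) (𝓝 1) := by
  have hT : ∀ᶠ T : ℝ in 𝓝[<] 1, |T| < 1 := by
    filter_upwards [Ioo_mem_nhdsLT (show (-1 : ℝ) < 1 by norm_num)] with T hT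
    exact abs_lt.2 hT
  refine tendsto_order.2 ⟨fun a ha => ?_, fun b hb => ?_⟩
  · have h0 : 0 < max a (1 / 2) := by positivity
    have h1 : max a (1 / 2) < 1 := max_lt ha (by norm_num)
    filter_upwards [hT, (tendsto_balanceMean_one h0).eventually_lt_const
      (balanceMean_one_left_lt h0 h1)] with T hT h
    exact (le_max_left _ _).trans_lt ((lt_balanceParam_iff hT h0).2 h)
  · filter_upwards [hT] with T hT
    exact (balanceParam_mem_Icc hT).2.trans_lt hb

theorem tendsto_tanh_atTop : Tendsto Real.tanh atTop (𝓝[<] 1) := by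
  refine tendsto_nhdsWithin_iff.2 ⟨?_, Eventually.of_forall fun x => Real.tanh_lt_one x⟩
  have h (x : ℝ) : Real.tanh x = 1 - 2 * (Real.exp (2 * x) + 1)⁻¹ := by
    have h1 := tanh_half_eq (2 * x)
    have := Real.exp_pos (2 * x)
    rw [mul_div_cancel_left₀ x two_ne_zero] at h1
    rw [h1]
    field_simp
    ring
  have h2 : Tendsto (fun x : ℝ => (Real.exp (2 * x) + 1)⁻¹) atTop (𝓝 0) :=
    (tendsto_atTop_add_const_right _ _ (Real.tendsto_exp_atTop.comp
      (tendsto_id.const_mul_atTop two_pos))).inv_tendsto_atTop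
  simpa [← h] using (h2.const_mul 2).const_sub 1

end BaryExt
end

noncomputable section
namespace BaryExt

/-! ### The barycentric extension of the squaring map -/

/-- The deviation of the radial coordinate of the barycentric extension from `log (cosh r)`. -/
def radialDefect (r : ℝ) : ℝ := -(1 / 2 * Real.log (balanceParam (Real.tanh r)))

theorem exp_radial_sq (r : ℝ) : Real.exp (Real.log (Real.cosh r) - radialDefect r) ^ 2 =
    balanceParam (Real.tanh r) * Real.cosh r ^ 2 := by
  have hκ := (balanceParam_spec (Real.abs_tanh_lt_one r)).1
  rw [radialDefect, sub_neg_eq_add, Real.exp_add, Real.exp_log (Real.cosh_pos r), mul_pow,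
    ← Real.exp_nat_mul, Nat.cast_ofNat, ← mul_assoc, mul_one_div_cancel two_ne_zero, one_mul,
    Real.exp_log hκ, mul_comm]

theorem isBalancedAt_cylindrical_radialDefect (r θ h : ℝ) :
    IsBalancedAt (sphereMeasure.map (squareMap ∘ mobiusSphere (cylindrical r θ h)))
      (cylindrical (Real.log (Real.cosh r) - radialDefect r) (2 * θ) (2 * h)) :=
  isBalancedAt_cylindrical (isBalancedAt_polar (exp_radial_sq r)
    (balanceParam_spec (Real.abs_tanh_lt_one r)).2) θ h

theorem existsUnique_isBalancedAt (x : H3) :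
    ∃! y : H3, IsBalancedAt (sphereMeasure.map (squareMap ∘ mobiusSphere x)) y := by
  have hc : Continuous (squareMap ∘ mobiusSphere x) :=
    continuous_squareMap.comp (continuous_mobiusSphere x)
  have : IsProbabilityMeasure (sphereMeasure.map (squareMap ∘ mobiusSphere x)) :=
    Measure.isProbabilityMeasure_map hc.aemeasurable
  have : (sphereMeasure.map (squareMap ∘ mobiusSphere x)).IsOpenPosMeasure :=
    hc.isOpenPosMeasure_map (squareMap_surjective.comp (mobiusSphere_surjective x))
  obtain ⟨r, θ, h, -, rfl⟩ := exists_cylindrical x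
  exact ⟨_, isBalancedAt_cylindrical_radialDefect r θ h, fun y hy =>
    hy.unique (isBalancedAt_cylindrical_radialDefect r θ h)⟩

theorem barycentricExtension_cylindrical (r θ h : ℝ) :
    barycentricExtension squareMap (cylindrical r θ h) =
      cylindrical (Real.log (Real.cosh r) - radialDefect r) (2 * θ) (2 * h) :=
  (existsUnique_isBalancedAt _).unique
    (Classical.epsilon_spec ⟨_, isBalancedAt_cylindrical_radialDefect r θ h⟩)
    (isBalancedAt_cylindrical_radialDefect r θ h)

theorem analyticAt_radialDefect (r : ℝ) : AnalyticAt ℝ radialDefect r := by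
  have h1 : AnalyticAt ℝ Real.tanh r := by
    have h : Real.tanh = fun x => Real.sinh x / Real.cosh x :=
      funext fun x => Real.tanh_eq_sinh_div_cosh x
    rw [h]
    exact Real.analyticAt_sinh.div Real.analyticAt_cosh (Real.cosh_pos r).ne'
  have hT := Real.abs_tanh_lt_one r
  exact (analyticAt_const.mul
    (((analyticAt_balanceParam hT).comp h1).log (balanceParam_spec hT).1)).neg

theorem radialDefect_zero : radialDefect 0 = 0 := by
  simp [radialDefect, balanceParam_zero]

theorem radialDefect_pos {r : ℝ} (hr : 0 < r) : 0 < radialDefect r := by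
  have hT := Real.abs_tanh_lt_one r
  have h0 : Real.tanh r ≠ 0 := by
    rw [Real.tanh_eq_sinh_div_cosh]
    exact (div_pos (Real.sinh_pos_iff.2 hr) (Real.cosh_pos r)).ne'
  have := Real.log_neg (balanceParam_spec hT).1 (balanceParam_lt_one hT h0)
  rw [radialDefect]
  linarith

theorem tendsto_radialDefect : Tendsto radialDefect atTop (𝓝 0) := by
  have h := ((tendsto_balanceParam_one.comp tendsto_tanh_atTop).log one_ne_zero).const_mul (1 / 2)
  rw [Real.log_one, mul_zero] at h
  rw [← neg_zero]
  exact h.neg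

theorem radialDefect_le (r : ℝ) : radialDefect r ≤ Real.log (Real.cosh r) := by
  have h := (balanceParam_mem_Icc (Real.abs_tanh_lt_one r)).1
  have hc := Real.cosh_pos r
  rw [one_sub_tanh_sq] at h
  have h1 := Real.log_le_log (by positivity) h
  rw [Real.log_inv, Real.log_pow] at h1
  rw [radialDefect]
  push_cast at h1
  linarith

theorem coe_cylindrical_zero_zero (r : ℝ) :
    (cylindrical r 0 0 : E3) = !₂[Real.tanh (r / 2), 0, 0] := by
  have h : (axisPoint 0 : E3) = 0 := by
    rw [coe_axisPoint]
    apply ext_E3 <;> simp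
  rw [cylindrical, coe_mobiusBall, h, coe_polar_zero]
  simp [mobius]

theorem barycentricExtension_squareMap_equator_ne :
    (fun z : Complex.UnitDisc => barycentricExtension squareMap (equator z)) ≠
      fun z : Complex.UnitDisc => equator (z * z) := by
  intro heq
  have hlt : ‖((Real.tanh (1 / 2) : ℝ) : ℂ)‖ < 1 := by
    rw [Complex.norm_real]
    exact Real.abs_tanh_lt_one _
  set z : Complex.UnitDisc := Complex.UnitDisc.mk _ hlt with hz
  have hzc : (z : ℂ) = (Real.tanh (1 / 2) : ℝ) := rfl
  have h1 : equator z = cylindrical 1 0 0 := by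
    apply Subtype.ext
    rw [coe_cylindrical_zero_zero]
    simp only [equator, hzc, Complex.ofReal_re, Complex.ofReal_im]
  have h2 := congrFun heq z
  simp only [h1, barycentricExtension_cylindrical, mul_zero] at h2
  have h3 := congrArg (fun x : H3 => (x : E3) 0) h2
  have h4 := exp_radial_sq 1
  have h5 := balanceParam_lt_one (Real.abs_tanh_lt_one 1)
    (by
      rw [Real.tanh_eq_sinh_div_cosh]
      exact (div_pos (Real.sinh_pos_iff.2 one_pos) (Real.cosh_pos 1)).ne')
  rw [coe_cylindrical_zero_zero, tanh_half_eq] at h3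
  simp only [equator, Complex.UnitDisc.coe_mul, hzc, ← Complex.ofReal_mul, Complex.ofReal_re,
    Matrix.cons_val] at h3
  rw [tanh_half_eq] at h3
  have hE := Real.exp_pos (Real.log (Real.cosh 1) - radialDefect 1)
  have he := Real.exp_pos 1
  have hc : Real.cosh 1 = (Real.exp 1 ^ 2 + 1) / (2 * Real.exp 1) := by
    rw [Real.cosh_eq, Real.exp_neg]
    field_simp
  generalize Real.exp (Real.log (Real.cosh 1) - radialDefect 1) = E at *
  have hEc : E = Real.cosh 1 := by
    rw [hc]
    field_simp at h3 ⊢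
    linarith
  rw [hEc] at h4
  have := Real.cosh_pos 1
  nlinarith [sq_pos_of_pos this]

end BaryExt
end

theorem mainTheorem7 :
    -- the barycentric extension of `z²` is well defined
    (∀ x : BaryExt.H3, ∃! y : BaryExt.H3,
      BaryExt.IsBalancedAt
        (BaryExt.sphereMeasure.map (BaryExt.squareMap ∘ BaryExt.mobiusSphere x)) y) ∧
    -- its form in hyperbolic cylindrical coordinates
    (∃ δ : ℝ → ℝ,
      AnalyticOnNhd ℝ δ (Set.Ici 0) ∧
      δ 0 = 0 ∧
      (∀ r : ℝ, 0 < r → 0 < δ r) ∧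
      Tendsto δ atTop (𝓝 0) ∧
      ∀ r θ h : ℝ, 0 ≤ r →
        0 ≤ Real.log (Real.cosh r) - δ r ∧
        BaryExt.barycentricExtension BaryExt.squareMap (BaryExt.cylindrical r θ h) =
          BaryExt.cylindrical (Real.log (Real.cosh r) - δ r) (2 * θ) (2 * h)) ∧
    -- the restriction to the equatorial plane is not `z²`
    (fun z : Complex.UnitDisc =>
        BaryExt.barycentricExtension BaryExt.squareMap (BaryExt.equator z)) ≠
      fun z : Complex.UnitDisc => BaryExt.equator (z * z) :=
  ⟨BaryExt.existsUnique_isBalancedAt,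
    ⟨BaryExt.radialDefect, fun r _ => BaryExt.analyticAt_radialDefect r,
      BaryExt.radialDefect_zero, fun _ hr => BaryExt.radialDefect_pos hr,
      BaryExt.tendsto_radialDefect, fun r θ h _ =>
        ⟨sub_nonneg.2 (BaryExt.radialDefect_le r), BaryExt.barycentricExtension_cylindrical r θ h⟩⟩,
    BaryExt.barycentricExtension_squareMap_equator_ne⟩
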